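/- Let $(W,\mathcal S)$ be a finite Coxeter system with length function $\ell$, longest element $w_\circ$ and $N=\ell(w_\circ)$. Let $\mathrm c=\mathrm s_1\cdots \mathrm s_n$ be a word containing every simple reflection exactly once (a word for a Coxeter element $c=s_1\cdots s_n$), and let $m\ge 0$. Let $\mathrm w_\circ(\mathrm c)$ be the $c$-sorting word of $w_\circ$, i.e. the lexicographically first subword (by positions) of $\mathrm c^\infty=\mathrm c\,\mathrm c\,\mathrm c\cdots$ that is a reduced word for $w_\circ$; let $\widetilde{\mathrm w}_\circ(\mathrm c)$ be obtained from it by replacing each letter $s$ by $w_\circ s w_\circ^{-1}\in\mathcal S$; and let $\mathrm w_\circ^m(\mathrm c)=\mathrm w_\circ(\mathrm c)\,\widetilde{\mathrm w}_\circ(\mathrm c)\,\mathrm w_\circ(\mathrm c)\cdots$ ($m$ factors, alternating). For a word $\mathrm Q$ in $\mathcal S$, $w\in W$ and $a\ge 0$, let $\mathrm{Sub}(\mathrm Q,w,a)$ be the simplicial complex on the positions of $\mathrm Q$ whose facets are the sets of positions whose complement spells a word of length $a$ for $w$. A finite simplicial complex is called vertex-decomposable if it is pure and either equals $\{\emptyset\}$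 or has a vertex whose deletion and link are both vertex-decomposable. (1) For every initial segment $\mathrm Q=\mathrm q_1\cdots \mathrm q_p$ of $\mathrm w_\circ^m(\mathrm c)$, with $w=q_1\cdots q_p\in W$, the subword complex $\mathrm{Sub}(\mathrm c\mathrm Q,w,p)$ is vertex-decomposable. (2) In particular, the $m$-eralized $c$-cluster complex $\mathsf{Asso}^{(m)}(W,c)=\mathrm{Sub}(\mathrm c\,\mathrm w_\circ^m(\mathrm c),w_\circ^m,mN)$ is vertex-decomposable. (3) The lexicographic order on the facets of $\mathsf{Asso}^{(m)}(W,c)$ (each facet being read as its increasing list of positions in $\mathrm c\,\mathrm w_\circ^m(\mathrm c)$) is a shelling order. -/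

import Mathlib

/-! ### Simplicial complexes -/

/-- A simplicial complex on vertices in `α`, with the empty face included: a family of finite sets
that is closed under taking subsets. So `⊥` has no face at all, and `LowerSet.Iic ∅` is `{∅}`. -/
abbrev FaceComplex (α : Type*) := LowerSet (Finset α)

namespace FaceComplex

variable {α : Type*}

/-- The facets are the inclusion-maximal faces. -/
def facets (Δ : FaceComplex α) : Set (Finset α) :=
  {F | Maximal (· ∈ Δ) F}

/-- All facets have the same number of vertices. -/
def IsPure (Δ : FaceComplex α) : Prop :=
  ∀ F ∈ Δ.facets, ∀ G ∈ Δ.facets, F.card = G.card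

/-- The deletion of `v`: all faces that do not contain `v`. -/
def deletion (Δ : FaceComplex α) (v : α) : FaceComplex α where
  carrier := {F | F ∈ Δ ∧ v ∉ F}
  lower' := fun _ _ hle h => ⟨Δ.lower hle h.1, fun hv => h.2 (hle hv)⟩

/-- The link of `v`: all faces `F` with `v ∉ F` such that `F ∪ {v}` is a face. -/
def link [DecidableEq α] (Δ : FaceComplex α) (v : α) : FaceComplex α where
  carrier := {F | v ∉ F ∧ insert v F ∈ Δ}
  lower' := fun _ _ hle h =>
    ⟨fun hv => h.1 (hle hv), Δ.lower (Finset.insert_subset_insert v hle) h.2⟩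

/-- Vertex-decomposability: `Δ` is pure, and either `Δ = {∅}`, or for some vertex `v` of `Δ` both
the deletion and the link of `v` are vertex-decomposable. -/
inductive VertexDecomposable [DecidableEq α] : FaceComplex α → Prop
  | singleton_empty : VertexDecomposable (LowerSet.Iic ∅)
  | step (Δ : FaceComplex α) (v : α) (pure : Δ.IsPure) (vertex : {v} ∈ Δ)
      (deletion : VertexDecomposable (Δ.deletion v)) (link : VertexDecomposable (Δ.link v)) :
      VertexDecomposable Δ

/-- The relation `r` ("comes strictly before") is a shelling order of `Δ`: `Δ` has finitely many
facets, `r` is a strict total order on them, and for every facet `G` the faces of `G` that lie in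
an earlier facet form a complex that is pure of codimension one in `G`, that is, each intersection
`F ∩ G` with an earlier facet `F` is contained in some `H ∩ G = G \ {v}` with `H` an
earlier facet and `v ∈ G`. -/
structure IsShellingOrder [DecidableEq α] (Δ : FaceComplex α)
    (r : Finset α → Finset α → Prop) : Prop where
  finite : Δ.facets.Finite
  irrefl : ∀ F ∈ Δ.facets, ¬ r F F
  trans : ∀ F ∈ Δ.facets, ∀ G ∈ Δ.facets, ∀ H ∈ Δ.facets, r F G → r G H → r F H
  total : ∀ F ∈ Δ.facets, ∀ G ∈ Δ.facets, F ≠ G → r F G ∨ r G F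
  shelling : ∀ F ∈ Δ.facets, ∀ G ∈ Δ.facets, r F G →
    ∃ H ∈ Δ.facets, r H G ∧ ∃ v ∈ G, F ∩ G ⊆ G.erase v ∧ H ∩ G = G.erase v

/-- The lexicographic order on sets of positions: the increasing lists of their elements are
compared lexicographically. -/
def lexLT {k : ℕ} (F G : Finset (Fin k)) : Prop :=
  F.sort (· ≤ ·) < G.sort (· ≤ ·)

end FaceComplex

/-! ### Coxeter elements and sorting words -/

namespace CoxeterSystem

variable {B W : Type*} [Group W] {M : CoxeterMatrix B} (cs : CoxeterSystem M W)

/-- A word `s₁ ⋯ sₙ` for a (standard) Coxeter element: every simple reflection occurs in it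
exactly once. -/
def IsCoxeterWord (c : List B) : Prop :=
  c.Nodup ∧ ∀ i, i ∈ c

/-- The letter at position `k` (counted from `0`) of the infinite word `c^∞ = c c c ⋯`. It is
`none` only if `c` is empty. -/
def infiniteLetter (c : List B) (k : ℕ) : Option B :=
  getElem? c (k % c.length)

/-- The positions `f` form a subword of `c^∞` that spells the word `ω`, and `ω` is a reduced
word for `w`. -/
def IsReducedSubword (c : List B) (w : W) (f : Fin (cs.length w) → ℕ) (ω : List B) : Prop :=
  StrictMono f ∧ ω.map some = List.ofFn (fun j => infiniteLetter c (f j)) ∧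
    cs.IsReduced ω ∧ cs.wordProd ω = w

/-- `ω` is the `c`-sorting word of `w`: the lexicographically first subword of `c^∞` that is a
reduced word for `w`. -/
def IsSortingWord (c : List B) (w : W) (ω : List B) : Prop :=
  ∃ f : Fin (cs.length w) → ℕ, cs.IsReducedSubword c w f ω ∧
    ∀ f' ω', cs.IsReducedSubword c w f' ω' → toLex f ≤ toLex f'

theorem exists_isSortingWord {c : List B} (hc : IsCoxeterWord c) (w : W) :
    ∃ ω, cs.IsSortingWord c w ω := by
  classical
  obtain ⟨ω, hred, hw⟩ := cs.exists_isReduced w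
  have hlen : cs.length w = ω.length := by rw [hw]; exact hred
  let S : Set (Lex (Fin (cs.length w) → ℕ)) :=
    {f | ∃ ω, cs.IsReducedSubword c w (ofLex f) ω}
  have hS : S.Nonempty := by
    have hidx (j : Fin (cs.length w)) : c.idxOf (ω.get (j.cast hlen)) < c.length :=
      List.idxOf_lt_length_iff.2 (hc.2 _)
    refine ⟨toLex fun j => c.length * j + c.idxOf (ω.get (j.cast hlen)), ω, ?_, ?_, hred, hw.symm⟩
    · intro i j hij
      have h1 := hidx i
      have h2 : c.length * (i + 1) ≤ c.length * j := Nat.mul_le_mul_left _ hij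
      simp only [ofLex_toLex]
      rw [Nat.mul_add] at h2
      omega
    · apply List.ext_getElem
      · simp [hlen]
      · intro k h1 h2
        have hk : k < cs.length w := by simpa using h2
        have h3 := hidx ⟨k, hk⟩
        simp only [Fin.cast_mk, List.get_eq_getElem] at h3
        simp only [List.getElem_map, List.getElem_ofFn, infiniteLetter, ofLex_toLex,
          Fin.cast_mk, List.get_eq_getElem, Nat.mul_add_mod, Nat.mod_eq_of_lt h3]
        rw [List.getElem?_eq_getElem h3, List.getElem_idxOf]
  obtain ⟨f, ⟨ω', hf⟩, hmin⟩ := WellFounded.has_min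
    (wellFounded_lt (α := Lex (Fin (cs.length w) → ℕ))) S hS
  exact ⟨ω', ofLex f, hf, fun f' ω'' h' => not_lt.1 (hmin (toLex f') ⟨ω'', h'⟩)⟩

/-- The `c`-sorting word of `w`. -/
noncomputable def sortingWord {c : List B} (hc : IsCoxeterWord c) (w : W) : List B :=
  (cs.exists_isSortingWord hc w).choose

/-- The longest element `w_∘` of a finite Coxeter group. -/
noncomputable def longest [Finite W] : W :=
  (Finite.exists_max cs.length).choose

/-- Conjugation by `w_∘` on the letters: `i` is sent to the `j` with `s_j = w_∘ s_i w_∘⁻¹`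
(the conjugate of a simple reflection by `w_∘` is again a simple reflection). -/
noncomputable def conjLongest [Finite W] (i : B) : B :=
  haveI : Nonempty B := ⟨i⟩
  Function.invFun cs.simple (cs.longest * cs.simple i * cs.longest⁻¹)

/-- The word `w_∘^m(c) = w_∘(c) w̃_∘(c) w_∘(c) ⋯` with `m` factors, alternating between the
`c`-sorting word of `w_∘` and its letterwise conjugate by `w_∘`. -/
noncomputable def longestPowWord [Finite W] {c : List B} (hc : IsCoxeterWord c) (m : ℕ) : List B :=
  (List.range m).flatMap fun k =>
    if Even k then cs.sortingWord hc cs.longest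
    else (cs.sortingWord hc cs.longest).map cs.conjLongest

/-! ### Subword complexes -/

/-- The word that is left of `Q` after the letters at the positions in `F` are removed. -/
def complementWord (Q : List B) (F : Finset (Fin Q.length)) : List B :=
  ((List.finRange Q.length).filter (· ∉ F)).map Q.get

/-- The subword complex `Sub(Q, w, a)`, on the positions of `Q`: its facets are the sets of
positions whose complement is a word for `w` of length `a`. -/
def subwordComplex (Q : List B) (w : W) (a : ℕ) : FaceComplex (Fin Q.length) :=
  lowerClosure {F | (complementWord Q F).length = a ∧ cs.wordProd (complementWord Q F) = w}

/-- The `m`-eralized `c`-cluster complex `Asso^(m)(W, c) = Sub(c w_∘^m(c), w_∘^m, m N)`, where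
`N` is the length of `w_∘`. -/
noncomputable def clusterComplex [Finite W] {c : List B} (hc : IsCoxeterWord c) (m : ℕ) :
    FaceComplex (Fin (c ++ cs.longestPowWord hc m).length) :=
  cs.subwordComplex (c ++ cs.longestPowWord hc m) (cs.longest ^ m) (m * cs.length cs.longest)

end CoxeterSystem

/-!
Realize `W` on `ℝⁿ` and let `E` be the Euler form of `c`: its symmetrization is the canonical form,
and `E (x - c x) y` is the canonical form of `x` and `y`. To each letter of `c Q` belongs an
inversion; take its root and move it by `c⁻¹`. Removing a set of positions leaves a word for `w` of
the right length exactly if the set has `n` elements and the reflections in its roots multiply to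
`c⁻¹`. By linear algebra this says that the Gram matrix of these roots for `E` is triangular: the
facets are the complete exceptional sets of the sequence of roots.

Given two exceptional sets of the same subspace, the largest element `l` of one lying beyond all
elements of the other, `l` can be exchanged for an earlier position. Otherwise mutate the root at
`l` to the left past the other members of its set. On windows of length `N` the form `E` takes
nonnegative values on the sequence of roots, and this keeps the mutated root in the sequence, at a
position from `l` on; past the roots of the leading `c` it only gains nonnegative multiples of them.
What remains is a root `x` for which the mutation identity equates quantities of opposite signs, so
`x` is orthogonal to the whole second set, hence to itself, although `E x x > 0`.

An exchange of the last element propagates to any element at which two facets differ while they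
agree beyond it. This gives the lexicographic shelling; since deleting or linking the last position
preserves the exchange property, it also gives a vertex decomposition.
-/

/-! ### Lexicographic exchange -/

namespace FaceComplex

section LowerClosure

variable {α : Type*} {𝓕 : Set (Finset α)}

theorem facets_lowerClosure_of_card {d : ℕ} (h𝓕 : ∀ F ∈ 𝓕, F.card = d) :
    facets (lowerClosure 𝓕) = 𝓕 := by
  ext F
  constructor
  · rintro ⟨⟨G, hG, hFG⟩, hmax⟩
    have hGF : G ≤ F := hmax (subset_lowerClosure hG) hFG
    rwa [le_antisymm hFG hGF]
  · intro hF
    refine ⟨subset_lowerClosure hF, ?_⟩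
    rintro G ⟨H, hH, hGH⟩ hFG
    have hFH : F = H :=
      Finset.eq_of_subset_of_card_le (hFG.trans hGH) (by rw [h𝓕 F hF, h𝓕 H hH])
    exact hFH ▸ hGH

theorem link_lowerClosure [DecidableEq α] (v : α) :
    link (lowerClosure 𝓕) v = lowerClosure {F | v ∉ F ∧ insert v F ∈ 𝓕} := by
  ext F
  constructor
  · rintro ⟨hvF, G, hG, hFG⟩
    have hvG : v ∈ G := hFG (Finset.mem_insert_self v F)
    refine ⟨G.erase v, ⟨Finset.notMem_erase v G, by rwa [Finset.insert_erase hvG]⟩, ?_⟩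
    exact Finset.subset_erase.2 ⟨(Finset.subset_insert v F).trans hFG, hvF⟩
  · rintro ⟨G, ⟨hvG, hG⟩, hFG⟩
    exact ⟨fun hv => hvG (hFG hv), insert v G, hG, Finset.insert_subset_insert v hFG⟩

theorem deletion_lowerClosure_of_forall_mem [DecidableEq α] {v : α} (hv : ∀ F ∈ 𝓕, v ∈ F) :
    deletion (lowerClosure 𝓕) v = link (lowerClosure 𝓕) v := by
  ext F
  constructor
  · rintro ⟨⟨G, hG, hFG⟩, hvF⟩
    exact ⟨hvF, G, hG, Finset.insert_subset (hv G hG) hFG⟩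
  · rintro ⟨hvF, G, hG, hFG⟩
    exact ⟨⟨G, hG, (Finset.subset_insert v F).trans hFG⟩, hvF⟩

end LowerClosure

section LexExchange

variable {α : Type*} [LinearOrder α] {𝓕 : Set (Finset α)}

/-- A family of finite sets has the lexicographic exchange property if, whenever two of its
members `F` and `G` agree above an element `v` of `G \ F`, the element `v` of `G` can be exchanged
for a smaller one. It makes deleting the largest vertex first a vertex decomposition, and the
lexicographic order a shelling order. -/
def LexExchange (𝓕 : Set (Finset α)) : Prop :=
  ∀ F ∈ 𝓕, ∀ G ∈ 𝓕, ∀ v ∈ G, v ∉ F → (∀ i, v < i → (i ∈ F ↔ i ∈ G)) →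
    ∃ x < v, x ∉ G ∧ insert x (G.erase v) ∈ 𝓕

theorem LexExchange.link_facets (h : LexExchange 𝓕) {l : α} (hl : ∀ F ∈ 𝓕, ∀ i ∈ F, i ≤ l) :
    LexExchange {F | l ∉ F ∧ insert l F ∈ 𝓕} := by
  rintro F ⟨-, hF⟩ G ⟨hlG, hG⟩ v hvG hvF hagree
  have hvl : v ≠ l := fun h => hlG (h ▸ hvG)
  obtain ⟨x, hxv, hxG, hx⟩ := h _ hF _ hG v (Finset.mem_insert_of_mem hvG)
    (by simp [hvl, hvF]) fun i hi => by simp [hagree i hi]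
  have hxl : x < l := hxv.trans_le (hl _ hG v (Finset.mem_insert_of_mem hvG))
  refine ⟨x, hxv, fun h => hxG (Finset.mem_insert_of_mem h), by simp [hxl.ne', hlG], ?_⟩
  rwa [Finset.insert_comm, ← Finset.erase_insert_of_ne hvl.symm]

theorem LexExchange.deletion_facets (h : LexExchange 𝓕) {l : α} (hl : ∀ F ∈ 𝓕, ∀ i ∈ F, i ≤ l) :
    LexExchange {F ∈ 𝓕 | l ∉ F} := by
  rintro F ⟨hF, -⟩ G ⟨hG, hlG⟩ v hvG hvF hagree
  obtain ⟨x, hxv, hxG, hx⟩ := h F hF G hG v hvG hvF hagree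
  have hxl : x < l := hxv.trans_le (hl G hG v hvG)
  exact ⟨x, hxv, hxG, hx, by simp [hxl.ne', hlG]⟩

theorem LexExchange.deletion_lowerClosure (h : LexExchange 𝓕) {l : α}
    (hl : ∀ F ∈ 𝓕, ∀ i ∈ F, i ≤ l) (hne : ∃ F ∈ 𝓕, l ∉ F) :
    deletion (lowerClosure 𝓕) l = lowerClosure {F ∈ 𝓕 | l ∉ F} := by
  obtain ⟨F₀, hF₀, hlF₀⟩ := hne
  ext F
  constructor
  · rintro ⟨⟨G, hG, hFG⟩, hlF⟩
    by_cases hlG : l ∈ G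
    · obtain ⟨x, hxl, -, hx⟩ := h F₀ hF₀ G hG l hlG hlF₀ fun i hi =>
        iff_of_false (fun h => (hl F₀ hF₀ i h).not_gt hi) fun h => (hl G hG i h).not_gt hi
      refine ⟨_, ⟨hx, by simp [hxl.ne']⟩, ?_⟩
      exact (Finset.subset_erase.2 ⟨hFG, hlF⟩).trans (Finset.subset_insert x _)
    · exact ⟨G, ⟨hG, hlG⟩, hFG⟩
  · rintro ⟨G, ⟨hG, hlG⟩, hFG⟩
    exact ⟨⟨G, hG, hFG⟩, fun h => hlG (hFG h)⟩

theorem LexExchange.vertexDecomposable_lowerClosure (h : LexExchange 𝓕) {s : Finset α} {d : ℕ}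
    (hs : ∀ F ∈ 𝓕, F ⊆ s) (hcard : ∀ F ∈ 𝓕, F.card = d) (hne : 𝓕.Nonempty) :
    VertexDecomposable (lowerClosure 𝓕) := by
  induction s using Finset.induction_on_max generalizing 𝓕 d with
  | empty =>
    have h𝓕 : 𝓕 = {∅} := hne.subset_singleton_iff.1 fun F hF => Finset.subset_empty.1 (hs F hF)
    rw [h𝓕, lowerClosure_singleton]
    exact VertexDecomposable.singleton_empty
  | insert l s hsl ih =>
    have hl : ∀ F ∈ 𝓕, ∀ i ∈ F, i ≤ l := fun F hF i hi =>
      (Finset.mem_insert.1 (hs F hF hi)).elim le_of_eq fun h => (hsl i h).le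
    by_cases hvertex : ∃ F ∈ 𝓕, l ∈ F
    · obtain ⟨G, hG, hlG⟩ := hvertex
      have hlink : VertexDecomposable (link (lowerClosure 𝓕) l) := by
        rw [link_lowerClosure]
        refine ih (d := d - 1) (h.link_facets hl) (fun F hF => ?_) (fun F hF => ?_) ⟨G.erase l, ?_⟩
        · have := Finset.insert_subset_iff.1 (hs _ hF.2)
          exact (Finset.subset_insert_iff_of_notMem hF.1).1 this.2
        · rw [← hcard _ hF.2, Finset.card_insert_of_notMem hF.1, Nat.add_sub_cancel]
        · exact ⟨Finset.notMem_erase l G, by rwa [Finset.insert_erase hlG]⟩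
      refine .step _ l ?_ ⟨G, hG, Finset.singleton_subset_iff.2 hlG⟩ ?_ hlink
      · rw [IsPure, facets_lowerClosure_of_card hcard]
        exact fun F hF G hG => (hcard F hF).trans (hcard G hG).symm
      · by_cases hdel : ∃ F ∈ 𝓕, l ∉ F
        · rw [h.deletion_lowerClosure hl hdel]
          exact ih (h.deletion_facets hl)
            (fun F hF => (Finset.subset_insert_iff_of_notMem hF.2).1 (hs F hF.1))
            (fun F hF => hcard F hF.1) hdel
        · push Not at hdel
          rwa [deletion_lowerClosure_of_forall_mem hdel]
    · push Not at hvertex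
      exact ih h (fun F hF => (Finset.subset_insert_iff_of_notMem (hvertex F hF)).1 (hs F hF))
        hcard hne

end LexExchange

section LexLT

variable {k : ℕ}

theorem list_lt_of_forall_lt_mem_iff {α : Type*} [LinearOrder α] {l₁ l₂ : List α} {x : α}
    (h₁ : l₁.SortedLT) (h₂ : l₂.SortedLT) (hlen : l₁.length = l₂.length) (hx₁ : x ∈ l₁)
    (hx₂ : x ∉ l₂) (hagree : ∀ i < x, i ∈ l₁ ↔ i ∈ l₂) : l₁ < l₂ := by
  induction l₁ generalizing l₂ with
  | nil => simp at hx₁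
  | cons a t₁ ih =>
    obtain _ | ⟨b, t₂⟩ := l₂
    · simp at hlen
    obtain ⟨ha, ht₁⟩ := List.pairwise_cons.1 h₁.pairwise
    obtain ⟨hb, ht₂⟩ := List.pairwise_cons.1 h₂.pairwise
    rw [List.cons_lt_cons_iff]
    rcases lt_trichotomy a b with hab | rfl | hba
    · exact .inl hab
    · exact .inr ⟨rfl, ih ht₁.sortedLT ht₂.sortedLT (by simpa using hlen) (by grind) (by grind)
        (by grind)⟩
    · grind

theorem lexLT_insert_erase {G : Finset (Fin k)} {x v : Fin k} (hv : v ∈ G) (hx : x ∉ G)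
    (hxv : x < v) : lexLT (insert x (G.erase v)) G := by
  refine list_lt_of_forall_lt_mem_iff (x := x) (Finset.sortedLT_sort _) (Finset.sortedLT_sort _)
    ?_ (by simp) (by simpa using hx) fun i hi => ?_
  · rw [Finset.length_sort, Finset.length_sort, Finset.card_insert_of_notMem (by simp [hx]),
      Finset.card_erase_add_one hv]
  · simp [hi.ne, (hi.trans hxv).ne]

theorem exists_max_mem_symmDiff {α : Type*} [LinearOrder α] {F G : Finset α} (hne : F ≠ G) :
    ∃ v ∈ symmDiff F G, ∀ i, v < i → (i ∈ F ↔ i ∈ G) := by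
  have hsymm : (symmDiff F G).Nonempty :=
    Finset.nonempty_iff_ne_empty.2 fun h => hne (symmDiff_eq_bot.1 h)
  refine ⟨_, Finset.max'_mem _ hsymm, fun i hi => ?_⟩
  have : i ∉ symmDiff F G := fun h => (Finset.le_max' _ i h).not_gt hi
  rw [Finset.mem_symmDiff] at this
  tauto

theorem LexExchange.exists_of_lexLT {𝓕 : Set (Finset (Fin k))} (h : LexExchange 𝓕)
    {F G : Finset (Fin k)} (hF : F ∈ 𝓕) (hG : G ∈ 𝓕) (hlt : lexLT F G) :
    ∃ v ∈ G, v ∉ F ∧ ∃ x < v, x ∉ G ∧ insert x (G.erase v) ∈ 𝓕 := by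
  have hwf : WellFounded (lexLT (k := k)) :=
    haveI : IsTrans _ (lexLT (k := k)) := ⟨fun _ _ _ => lt_trans⟩
    haveI : Std.Irrefl (lexLT (k := k)) := ⟨fun _ => lt_irrefl _⟩
    Finite.wellFounded_of_trans_of_irrefl _
  induction F using hwf.induction with
  | _ F ih =>
    obtain ⟨v, hv, hagree⟩ := exists_max_mem_symmDiff (F := F) (G := G)
      fun h => lt_irrefl (G.sort (· ≤ ·)) (h ▸ hlt : lexLT G G)
    rcases Finset.mem_symmDiff.1 hv with ⟨hvF, hvG⟩ | ⟨hvG, hvF⟩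
    · obtain ⟨x, hxv, hxF, hF'⟩ := h G hG F hF v hvF hvG fun i hi => (hagree i hi).symm
      have hF'F := lexLT_insert_erase hvF hxF hxv
      obtain ⟨u, huG, huF', hu⟩ := ih _ hF'F hF' (lt_trans hF'F hlt)
      exact ⟨u, huG, fun huF => huF' (Finset.mem_insert_of_mem
        (Finset.mem_erase.2 ⟨fun h => hvG (h ▸ huG), huF⟩)), hu⟩
    · exact ⟨v, hvG, hvF, h F hF G hG v hvG hvF hagree⟩

theorem LexExchange.isShellingOrder_lexLT {Δ : FaceComplex (Fin k)}
    (h : LexExchange Δ.facets) : Δ.IsShellingOrder lexLT where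
  finite := Set.toFinite _
  irrefl _ _ := lt_irrefl _
  trans _ _ _ _ _ _ := lt_trans
  total F _ G _ hne := lt_or_gt_of_ne fun hsort => hne (by
    rw [← Finset.sort_toFinset F (· ≤ ·), hsort, Finset.sort_toFinset])
  shelling F hF G hG hFG := by
    obtain ⟨v, hvG, hvF, x, hxv, hxG, hH⟩ := h.exists_of_lexLT hF hG hFG
    refine ⟨_, hH, lexLT_insert_erase hvG hxG hxv, v, hvG, ?_, ?_⟩
    · exact Finset.subset_erase.2
        ⟨Finset.inter_subset_right, fun h => hvF (Finset.mem_of_mem_inter_left h)⟩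
    · rw [Finset.insert_inter_of_notMem hxG]
      exact Finset.inter_eq_left.2 (Finset.erase_subset v G)

end LexLT

end FaceComplex

namespace ClusterComplex

open CoxeterSystem FaceComplex

/-! ### Exceptional sets -/

section Exceptional

variable {K V ι : Type*} [Field K] [AddCommGroup V] [Module K V]

/-- The reflection of `x` along `g` that is orthogonal for the symmetrization of `E`. The vector
`g` is the second argument so that products of reflections are left folds. -/
def reflectAlong (E : LinearMap.BilinForm K V) (x g : V) : V :=
  x - ((E x g + E g x) / E g g) • g

/-- The vectors `η i`, `i ∈ G`, lie in `U`, are as many as the dimension of `U`, and their Gram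
matrix with respect to the bilinear form `E` is triangular: the analogue of a complete exceptional
sequence for an Euler form `E`. -/
structure IsExceptional [LinearOrder ι] (E : LinearMap.BilinForm K V) (η : ι → V)
    (U : Submodule K V) (G : Finset ι) : Prop where
  mem : ∀ i ∈ G, η i ∈ U
  triangular : ∀ i ∈ G, ∀ j ∈ G, i < j → E (η j) (η i) = 0
  card_eq : G.card = Module.finrank K U

/-- The element `l` of the exceptional set `G` can be exchanged for a smaller one. -/
def CanExchange [LinearOrder ι] (E : LinearMap.BilinForm K V) (η : ι → V) (U : Submodule K V)
    (G : Finset ι) (l : ι) : Prop :=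
  ∃ x < l, x ∉ G ∧ IsExceptional E η U (insert x (G.erase l))

/-- The largest element of an exceptional set can be exchanged for a smaller one, as soon as there
is an exceptional set of smaller elements. -/
def ExchangeProperty [LinearOrder ι] (E : LinearMap.BilinForm K V) (η : ι → V) : Prop :=
  ∀ (U : Submodule K V) (G G' : Finset ι) (l : ι), IsExceptional E η U G →
    IsExceptional E η U G' → l ∈ G → (∀ i ∈ G, i ≤ l) → (∀ i ∈ G', i < l) →
    CanExchange E η U G l

theorem finrank_inf_ker_add_one [FiniteDimensional K V] {U : Submodule K V} {f : V →ₗ[K] K} {v : V}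
    (hv : v ∈ U) (hf : f v ≠ 0) :
    Module.finrank K (U ⊓ LinearMap.ker f : Submodule K V) + 1 = Module.finrank K U := by
  have hrange : LinearMap.range (f.domRestrict U) = ⊤ :=
    LinearMap.range_eq_top.2 <| LinearMap.surjective fun h =>
      hf (by simpa using congrArg (fun f => f ⟨v, hv⟩) h)
  have hker : Module.finrank K (LinearMap.ker (f.domRestrict U)) =
      Module.finrank K (U ⊓ LinearMap.ker f : Submodule K V) := by
    rw [LinearMap.domRestrict, LinearMap.ker_comp, ← Submodule.map_comap_subtype]
    exact LinearEquiv.finrank_eq (Submodule.equivMapOfInjective _ U.injective_subtype _)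
  have hrank := LinearMap.finrank_range_add_finrank_ker (f.domRestrict U)
  rw [hrange, finrank_top, Module.finrank_self, hker] at hrank
  omega

namespace IsExceptional

variable [LinearOrder ι] {E : LinearMap.BilinForm K V} {η : ι → V} {U : Submodule K V}
  {F G : Finset ι} {l : ι}

theorem erase_top [FiniteDimensional K V] (h : IsExceptional E η U G) (hl : l ∈ G)
    (hmax : ∀ i ∈ G, i ≤ l) (hη : E (η l) (η l) ≠ 0) :
    IsExceptional E η (U ⊓ LinearMap.ker (E (η l))) (G.erase l) where
  mem i hi := by
    obtain ⟨hil, hi⟩ := Finset.mem_erase.1 hi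
    exact ⟨h.mem i hi, h.triangular i hi l hl ((hmax i hi).lt_of_ne hil)⟩
  triangular i hi j hj :=
    h.triangular i (Finset.mem_of_mem_erase hi) j (Finset.mem_of_mem_erase hj)
  card_eq := by
    have := finrank_inf_ker_add_one (h.mem l hl) hη
    rw [Finset.card_erase_of_mem hl, h.card_eq]
    omega

theorem insert_top [FiniteDimensional K V]
    (h : IsExceptional E η (U ⊓ LinearMap.ker (E (η l))) G) (hl : ∀ i ∈ G, i < l)
    (hU : η l ∈ U) (hη : E (η l) (η l) ≠ 0) :
    IsExceptional E η U (insert l G) where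
  mem := Finset.forall_mem_insert _ _ _ |>.2 ⟨hU, fun i hi => (h.mem i hi).1⟩
  triangular i hi j hj hij := by
    rw [Finset.mem_insert] at hi hj
    rcases hi with rfl | hi <;> rcases hj with rfl | hj
    · exact absurd hij (lt_irrefl _)
    · exact absurd hij (hl j hj).not_gt
    · exact (h.mem i hi).2
    · exact h.triangular i hi j hj hij
  card_eq := by
    rw [Finset.card_insert_of_notMem fun hlG => lt_irrefl _ (hl l hlG), h.card_eq,
      finrank_inf_ker_add_one hU hη]

theorem insert_erase {x : ι} (h : IsExceptional E η U G) (hl : l ∈ G) (hx : x ∉ G)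
    (hxU : η x ∈ U) (hlt : ∀ g ∈ G, g ≠ l → g < x → E (η x) (η g) = 0)
    (hgt : ∀ g ∈ G, g ≠ l → x < g → E (η g) (η x) = 0) :
    IsExceptional E η U (insert x (G.erase l)) where
  mem := Finset.forall_mem_insert _ _ _ |>.2
    ⟨hxU, fun i hi => h.mem i (Finset.mem_of_mem_erase hi)⟩
  triangular i hi j hj hij := by
    simp only [Finset.mem_insert, Finset.mem_erase] at hi hj
    rcases hi with rfl | ⟨hil, hi⟩ <;> rcases hj with rfl | ⟨hjl, hj⟩
    · exact absurd hij (lt_irrefl _)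
    · exact hgt j hj hjl hij
    · exact hlt i hi hil hij
    · exact h.triangular i hi j hj hij
  card_eq := by
    rw [Finset.card_insert_of_notMem (fun hx' => hx (Finset.mem_of_mem_erase hx')),
      Finset.card_erase_add_one hl, h.card_eq]

theorem linearIndepOn (h : IsExceptional E η U G) (hη : ∀ i, E (η i) (η i) ≠ 0) :
    LinearIndepOn K η (G : Set ι) := by
  classical
  rw [linearIndepOn_finset_iff]
  intro f hf
  by_contra! hne
  obtain ⟨i, hi, hfi⟩ := hne
  obtain ⟨l, hl, hmax⟩ := Finset.exists_max_image {j ∈ G | f j ≠ 0} id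
    ⟨i, Finset.mem_filter.2 ⟨hi, hfi⟩⟩
  obtain ⟨hlG, hfl⟩ := Finset.mem_filter.1 hl
  have hsum : E (η l) (∑ j ∈ G, f j • η j) = f l * E (η l) (η l) := by
    rw [map_sum, Finset.sum_eq_single l _ (absurd hlG), map_smul, smul_eq_mul]
    intro j hj hjl
    by_cases hfj : f j = 0
    · rw [hfj, zero_smul, map_zero]
    · have hlt : j < l := (hmax j (Finset.mem_filter.2 ⟨hj, hfj⟩)).lt_of_ne hjl
      rw [map_smul, h.triangular j hj l hlG hlt, smul_zero]
  rw [hf, map_zero] at hsum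
  exact mul_ne_zero hfl (hη l) hsum.symm

theorem span_eq [FiniteDimensional K V] (h : IsExceptional E η U G)
    (hη : ∀ i, E (η i) (η i) ≠ 0) : Submodule.span K (η '' G) = U := by
  refine Submodule.eq_of_le_of_finrank_le (Submodule.span_le.2 (Set.image_subset_iff.2 h.mem)) ?_
  have hspan := finrank_span_eq_card (h.linearIndepOn hη)
  rw [Set.range_comp', Subtype.range_coe] at hspan
  rw [hspan, ← h.card_eq]
  exact (Fintype.card_coe G).ge

theorem eq_zero_of_forall_mem [FiniteDimensional K V] (h : IsExceptional E η U G)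
    (hη : ∀ i, E (η i) (η i) ≠ 0) {f : V →ₗ[K] K} (hf : ∀ i ∈ G, f (η i) = 0) {u : V}
    (hu : u ∈ U) : f u = 0 := by
  rw [← h.span_eq hη] at hu
  have hle : Submodule.span K (η '' G) ≤ LinearMap.ker f :=
    Submodule.span_le.2 (Set.image_subset_iff.2 hf)
  exact hle hu

theorem canExchange [FiniteDimensional K V] (hη : ∀ i, E (η i) (η i) ≠ 0)
    (hex : ExchangeProperty E η) (hF : IsExceptional E η U F) (hG : IsExceptional E η U G) {v : ι}
    (hvG : v ∈ G) (hvF : v ∉ F) (hagree : ∀ i, v < i → (i ∈ F ↔ i ∈ G)) :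
    CanExchange E η U G v := by
  induction hd : G.card generalizing U F G with
  | zero => simp [Finset.card_eq_zero.1 hd] at hvG
  | succ d ih =>
    obtain ⟨l, hlG, hmax⟩ := Finset.exists_max_image G id ⟨v, hvG⟩
    simp only [id] at hmax
    have hmaxF (i) (hi : i ∈ F) : i ≤ l := not_lt.1 fun hli =>
      (hmax i ((hagree i ((hmax v hvG).trans_lt hli)).1 hi)).not_gt hli
    rcases (hmax v hvG).eq_or_lt with rfl | hvl
    · exact hex U G F v hG hF hvG hmax fun i hi =>
        (hmaxF i hi).lt_of_ne (ne_of_mem_of_not_mem hi hvF)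
    obtain ⟨x, hxv, hxG, hx⟩ := ih (hF.erase_top ((hagree l hvl).2 hlG) hmaxF (hη l))
      (hG.erase_top hlG hmax (hη l)) (Finset.mem_erase.2 ⟨hvl.ne, hvG⟩)
      (fun h => hvF (Finset.mem_of_mem_erase h))
      (fun i hi => by rw [Finset.mem_erase, Finset.mem_erase, hagree i hi])
      (by rw [Finset.card_erase_of_mem hlG, hd, Nat.add_sub_cancel])
    have hxl := hxv.trans hvl
    refine ⟨x, hxv, fun h => hxG (Finset.mem_erase.2 ⟨hxl.ne, h⟩), ?_⟩
    rw [← Finset.insert_erase (Finset.mem_erase.2 ⟨hvl.ne', hlG⟩), Finset.insert_comm,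
      Finset.erase_right_comm]
    refine hx.insert_top (fun i hi => ?_) (hG.mem l hlG) (hη l)
    simp only [Finset.mem_insert, Finset.mem_erase] at hi
    rcases hi with rfl | ⟨-, hil, hi⟩
    · exact hxl
    · exact (hmax i hi).lt_of_ne hil

theorem lexExchange [FiniteDimensional K V] (hη : ∀ i, E (η i) (η i) ≠ 0)
    (hex : ExchangeProperty E η) : LexExchange {G | IsExceptional E η U G} :=
  fun _ hF _ hG _ => canExchange hη hex hF hG

end IsExceptional

theorem isExceptional_map_iff {κ : Type*} [LinearOrder ι] [LinearOrder κ]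
    {E : LinearMap.BilinForm K V} {η : ι → V} {U : Submodule K V} (e : κ ↪o ι) {G : Finset κ} :
    IsExceptional E η U (G.map e.toEmbedding) ↔ IsExceptional E (η ∘ e) U G := by
  constructor
  · rintro ⟨hmem, htri, hcard⟩
    exact ⟨by simpa using hmem, by simpa using htri, by rw [← hcard, Finset.card_map]⟩
  · rintro ⟨hmem, htri, hcard⟩
    exact ⟨by simpa using hmem, by simpa using htri, by rw [Finset.card_map, hcard]⟩

theorem ExchangeProperty.comp_finVal {E : LinearMap.BilinForm K V} {η : ℕ → V}
    (h : ExchangeProperty E η) (k : ℕ) : ExchangeProperty E (fun i : Fin k => η i) := by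
  intro U G G' l hG hG' hl hmax hG'l
  obtain ⟨x, hxl, hxG, hx⟩ := h U _ _ (l : ℕ)
    ((isExceptional_map_iff (Fin.valOrderEmb k)).2 hG)
    ((isExceptional_map_iff (Fin.valOrderEmb k)).2 hG') (Finset.mem_map_of_mem _ hl)
    (by simpa using fun i hi => hmax i hi) (by simpa using fun i hi => hG'l i hi)
  refine ⟨⟨x, hxl.trans l.2⟩, hxl, fun hxG' => hxG (Finset.mem_map_of_mem _ hxG'), ?_⟩
  refine (isExceptional_map_iff (Fin.valOrderEmb k)).1 ?_
  rw [Finset.map_insert, Finset.map_erase]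
  exact hx

end Exceptional

/-! ### Left mutations -/

section LeftMutation

variable {K V : Type*} [Field K] [AddCommGroup V] [Module K V]

/-- The vector `y` is what becomes of `η l`, up to a scalar, when the exceptional sequence
`(η g)`, `g ∈ G`, is modified by moving its last term to the left past all `g ≥ b`. -/
structure IsLeftMutation (E : LinearMap.BilinForm K V) (η : ℕ → V) (U : Submodule K V)
    (G : Finset ℕ) (l b : ℕ) (y : V) : Prop where
  mem : y ∈ U
  left : ∀ g ∈ G, g < b → E y (η g) = 0
  right : ∀ g ∈ G, b ≤ g → g < l → E (η g) y = 0

namespace IsLeftMutation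

variable {E : LinearMap.BilinForm K V} {η : ℕ → V} {U : Submodule K V} {G : Finset ℕ}
  {l b : ℕ} {y : V}

theorem self (hG : IsExceptional E η U G) (hl : l ∈ G) : IsLeftMutation E η U G l l (η l) where
  mem := hG.mem l hl
  left g hg := hG.triangular g hg l hl
  right _ _ hlg hgl := absurd hgl hlg.not_gt

theorem neg (h : IsLeftMutation E η U G l b y) : IsLeftMutation E η U G l b (-y) where
  mem := U.neg_mem h.mem
  left g hg hgb := by rw [map_neg, LinearMap.neg_apply, h.left g hg hgb, neg_zero]
  right g hg hbg hgl := by rw [map_neg, h.right g hg hbg hgl, neg_zero]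

theorem of_notMem (h : IsLeftMutation E η U G l (b + 1) y) (hb : b ∉ G) :
    IsLeftMutation E η U G l b y where
  mem := h.mem
  left g hg hgb := h.left g hg (by omega)
  right g hg hbg := h.right g hg (hbg.lt_of_ne (ne_of_mem_of_not_mem hg hb).symm)

theorem reflect (h : IsLeftMutation E η U G l (b + 1) y) (hG : IsExceptional E η U G) (hb : b ∈ G)
    (hηb : E (η b) (η b) ≠ 0) : IsLeftMutation E η U G l b (reflectAlong E y (η b)) where
  mem := U.sub_mem h.mem (U.smul_mem _ (hG.mem b hb))
  left g hg hgb := by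
    simp [reflectAlong, h.left g hg (by omega), hG.triangular g hg b hb hgb]
  right g hg hbg hgl := by
    rcases hbg.eq_or_lt with rfl | hbg
    · simp [reflectAlong, h.left b hg b.lt_succ_self, hηb]
    · simp [reflectAlong, h.right g hg hbg hgl, hG.triangular b hb g hg hbg]

theorem canExchange (h : IsLeftMutation E η U G l b (η b)) (hG : IsExceptional E η U G)
    (hl : l ∈ G) (hmax : ∀ g ∈ G, g ≤ l) (hb : b ∉ G) (hbl : b < l) : CanExchange E η U G l :=
  ⟨b, hbl, hb, hG.insert_erase hl hb h.mem (fun g hg _ => h.left g hg)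
    fun g hg hgl hbg => h.right g hg hbg.le ((hmax g hg).lt_of_ne hgl)⟩

/-- Both sides are linear in `u` and agree at the members of `G`, which span `U`. -/
theorem mul_apply_eq [FiniteDimensional K V] (h : IsLeftMutation E η U G l 0 y)
    (hG : IsExceptional E η U G) (hη : ∀ i, E (η i) (η i) ≠ 0) (hl : l ∈ G)
    (hmax : ∀ g ∈ G, g ≤ l) {u : V} (hu : u ∈ U) :
    E (η l) (η l) * E u y = E (η l) y * E (η l) u := by
  refine sub_eq_zero.1 (hG.eq_zero_of_forall_mem hη
    (f := E (η l) (η l) • LinearMap.flip E y - E (η l) y • E (η l)) (fun g hg => ?_) hu)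
  simp only [LinearMap.sub_apply, LinearMap.smul_apply, LinearMap.flip_apply, smul_eq_mul]
  rcases (hmax g hg).eq_or_lt with rfl | hgl
  · ring
  · rw [h.right g hg g.zero_le hgl, hG.triangular g hg l hl hgl, mul_zero, mul_zero, sub_zero]

end IsLeftMutation

end LeftMutation

/-! ### Sorted root sequences -/

/-- The `n` vectors `ρ`, followed by the sequence `γ`. -/
def positionVector {V : Type*} (n : ℕ) (ρ γ : ℕ → V) (j : ℕ) : V :=
  if j < n then ρ j else γ (j - n)

theorem positionVector_of_lt {V : Type*} {n : ℕ} {ρ γ : ℕ → V} {j : ℕ} (h : j < n) :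
    positionVector n ρ γ j = ρ j := if_pos h

theorem positionVector_add {V : Type*} {n : ℕ} {ρ γ : ℕ → V} (j : ℕ) :
    positionVector n ρ γ (n + j) = γ j := by
  simp [positionVector]

section SortedRootSequence

variable {K V : Type*} [Field K] [LinearOrder K] [AddCommGroup V] [Module K V]

/-- The `n` vectors `ρ` and the antiperiodic sequence `γ`, one half-period of which lists the
positive roots of `Φ` in an order compatible with the form `E`; the linear map `c` plays the role
of a Coxeter element, and the `ρ a` are the positive roots that it makes negative. -/
structure IsSortedRootSequence (E : LinearMap.BilinForm K V) (Φ : Set V) (c : V →ₗ[K] V)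
    (n N : ℕ) (ρ γ : ℕ → V) : Prop where
  pos : ∀ x, x ≠ 0 → 0 < E x x
  ne_zero : ∀ x ∈ Φ, x ≠ 0
  γ_mem : ∀ i, γ i ∈ Φ
  ρ_mem : ∀ a < n, ρ a ∈ Φ
  reflect_mem : ∀ x ∈ Φ, ∀ g ∈ Φ, reflectAlong E x g ∈ Φ
  c_mem : ∀ x ∈ Φ, c x ∈ Φ
  serre : ∀ x y, E y x = - E (c x) y
  antiperiodic : ∀ i, γ (i + N) = - γ i
  nonneg : ∀ i j, i ≤ j → j < i + N → 0 ≤ E (γ i) (γ j)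
  cover : ∀ x ∈ Φ, ∃ i < N, x = γ i ∨ x = - γ i
  coef_nonneg : ∀ i < N, ∀ b < n, 0 ≤ E (γ i) (ρ b)
  ρ_triangular : ∀ a < n, ∀ b < a, E (ρ a) (ρ b) = 0
  eq_zero : ∀ x, (∀ b < n, E x (ρ b) = 0) → x = 0
  initial : ∀ i < N, ∀ j < N, c (γ i) = - γ j → ∃ a < n, γ i = ρ a

namespace IsSortedRootSequence

variable {E : LinearMap.BilinForm K V} {Φ : Set V} {c : V →ₗ[K] V} {n N : ℕ} {ρ γ : ℕ → V}
  {U : Submodule K V} {G : Finset ℕ} {l : ℕ}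

local notation "η" => positionVector n ρ γ

theorem γ_pos (h : IsSortedRootSequence E Φ c n N ρ γ) (i : ℕ) : 0 < E (γ i) (γ i) :=
  h.pos _ (h.ne_zero _ (h.γ_mem i))

theorem ρ_pos (h : IsSortedRootSequence E Φ c n N ρ γ) {b : ℕ} (hb : b < n) :
    0 < E (ρ b) (ρ b) :=
  h.pos _ (h.ne_zero _ (h.ρ_mem b hb))

theorem positionVector_pos (h : IsSortedRootSequence E Φ c n N ρ γ) (j : ℕ) :
    0 < E (positionVector n ρ γ j) (positionVector n ρ γ j) := by
  unfold positionVector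
  split_ifs with hj
  · exact h.ρ_pos hj
  · exact h.γ_pos _

/-- The window `(g, g + N]` is a half-period of the antiperiodic sequence. -/
theorem exists_window (h : IsSortedRootSequence E Φ c n N ρ γ) {x : V} (hx : x ∈ Φ) (g : ℕ) :
    ∃ i, g < i ∧ i ≤ g + N ∧ (γ i = x ∨ γ i = -x) := by
  have shift {i : ℕ} (hi : x = γ i ∨ x = -γ i) : γ (i + N) = x ∨ γ (i + N) = -x := by
    rw [h.antiperiodic]
    exact hi.symm.imp Eq.symm fun hi => congrArg Neg.neg hi.symm
  induction g with
  | zero =>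
    obtain ⟨i, hiN, hi⟩ := h.cover x hx
    rcases i.eq_zero_or_pos with rfl | hi0
    · exact ⟨0 + N, by omega, le_rfl, shift hi⟩
    · exact ⟨i, hi0, by omega, hi.imp Eq.symm fun hi => neg_eq_iff_eq_neg.1 hi.symm⟩
  | succ g ih =>
    obtain ⟨i, hgi, hiN, hi⟩ := ih
    rcases (Nat.succ_le_of_lt hgi).eq_or_lt with rfl | hlt
    · exact ⟨g + 1 + N, by omega, le_rfl,
        shift (hi.imp Eq.symm fun hi => neg_eq_iff_eq_neg.1 hi.symm)⟩
    · exact ⟨i, hlt, by omega, hi⟩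

theorem exists_c_γ_eq (h : IsSortedRootSequence E Φ c n N ρ γ) (hG : IsExceptional E η U G)
    (hl : n + l ∈ G) (hmax : ∀ g ∈ G, g ≤ n + l) (hcon : ¬CanExchange E η U G (n + l)) {b i : ℕ}
    (hb : b ≤ n) (hi : i < N) (hγ : IsLeftMutation E η U G (n + l) b (γ i)) :
    ∃ j < N, c (γ i) = γ j := by
  obtain ⟨j, hj, hcj | hcj⟩ := h.cover _ (h.c_mem _ (h.γ_mem i))
  · exact ⟨j, hj, hcj⟩
  obtain ⟨a, ha, hia⟩ := h.initial i hi j hj hcj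
  have hηa : η a = γ i := by rw [positionVector_of_lt ha, hia]
  rw [← hηa] at hγ
  have haa := (h.positionVector_pos a).ne'
  have haG : a ∉ G := fun haG => (lt_or_ge a b).elim (fun hab => haa (hγ.left a haG hab))
    fun hba => haa (hγ.right a haG hba (by omega))
  refine absurd ⟨a, by omega, haG, hG.insert_erase hl haG hγ.mem ?_ ?_⟩ hcon
  · intro g _ _ hga
    rw [positionVector_of_lt ha, positionVector_of_lt (hga.trans ha), h.ρ_triangular a ha g hga]
  · intro g hg hgl hag
    rcases lt_or_ge g n with hgn | hng
    · rw [positionVector_of_lt ha, positionVector_of_lt hgn, h.ρ_triangular g hgn a hag]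
    · exact hγ.right g hg (hb.trans hng) ((hmax g hg).lt_of_ne hgl)

variable [IsStrictOrderedRing K]

theorem nonpos (h : IsSortedRootSequence E Φ c n N ρ γ) {i j : ℕ} (hij : i < j)
    (hji : j ≤ i + N) : E (γ j) (γ i) ≤ 0 := by
  have := h.nonneg j (i + N) hji (by omega)
  rwa [h.antiperiodic, map_neg, Left.nonneg_neg_iff] at this

theorem exists_reflect_eq (h : IsSortedRootSequence E Φ c n N ρ γ) {g x : ℕ} (hgx : g < x)
    (hxg : x < g + N) (hE : E (γ x) (γ g) = 0) :
    ∃ x', x ≤ x' ∧ x' < g + N ∧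
      (γ x' = reflectAlong E (γ x) (γ g) ∨ γ x' = -reflectAlong E (γ x) (γ g)) := by
  have hgg := h.γ_pos g
  set y := reflectAlong E (γ x) (γ g) with hy
  have hgy : E (γ g) y = 0 := by simp [hy, reflectAlong, hE, hgg.ne']
  rcases (h.nonneg g x hgx.le hxg).eq_or_lt with h0 | hpos
  · exact ⟨x, le_rfl, hxg, .inl (by simp [hy, reflectAlong, hE, ← h0])⟩
  have hyg : E y (γ g) < 0 := by simpa [hy, reflectAlong, hE, hgg.ne'] using hpos
  have hxy : 0 < E (γ x) y := by simpa [hy, reflectAlong, hE] using h.γ_pos x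
  obtain ⟨x', hgx', hx'g, hx'⟩ := h.exists_window (h.reflect_mem _ (h.γ_mem x) _ (h.γ_mem g)) g
  refine ⟨x', not_lt.1 fun hx'x => ?_, hx'g.lt_of_ne ?_, hx'⟩
  · have h1 := h.nonpos hgx' hx'g
    have h2 := h.nonpos hx'x (by omega)
    rcases hx' with hx' | hx'
    · rw [hx'] at h2
      exact hxy.not_ge h2
    · rw [hx', map_neg, LinearMap.neg_apply] at h1
      linarith
  · rintro rfl
    rw [h.antiperiodic, neg_eq_iff_eq_neg, neg_inj] at hx'
    refine hgg.ne' ?_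
    rcases hx' with hx' | hx' <;> nth_rw 2 [hx']
    · rw [map_neg, hgy, neg_zero]
    · exact hgy

theorem exists_eq_γ (h : IsSortedRootSequence E Φ c n N ρ γ) {x : V} (hx : x ∈ Φ)
    (hρ : ∀ b < n, 0 ≤ E x (ρ b)) : ∃ i < N, γ i = x := by
  obtain ⟨i, hi, rfl | rfl⟩ := h.cover x hx
  · exact ⟨i, hi, rfl⟩
  · refine absurd (h.eq_zero _ fun b hb => (hρ b hb).antisymm' ?_) (h.ne_zero _ hx)
    rw [map_neg, LinearMap.neg_apply, neg_nonpos]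
    exact h.coef_nonneg i hi b hb

theorem ρ_nonneg (h : IsSortedRootSequence E Φ c n N ρ γ) {a b : ℕ} (ha : a < n) (hb : b < n) :
    0 ≤ E (ρ a) (ρ b) := by
  obtain ⟨i, hi, hρ | hρ⟩ := h.cover _ (h.ρ_mem a ha)
  · rw [hρ]
    exact h.coef_nonneg i hi b hb
  · have haa := h.ρ_pos ha
    nth_rw 1 [hρ] at haa
    rw [map_neg, LinearMap.neg_apply, neg_pos] at haa
    exact absurd (h.coef_nonneg i hi a ha) haa.not_ge

theorem ρ_γ_nonpos (h : IsSortedRootSequence E Φ c n N ρ γ) {b i j : ℕ} (hb : b < n) (hj : j < N)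
    (hc : c (γ i) = γ j) : E (ρ b) (γ i) ≤ 0 := by
  rw [h.serre, hc, neg_nonpos]
  exact h.coef_nonneg j hj b hb

theorem exists_reflect_ρ_eq (h : IsSortedRootSequence E Φ c n N ρ γ) {b i j : ℕ} (hb : b < n)
    (hi : i < N) (hj : j < N) (hc : c (γ i) = γ j) (hE : E (γ i) (ρ b) = 0) :
    ∃ i' < N, γ i' = reflectAlong E (γ i) (ρ b) ∧
      ∀ k < N, 0 ≤ E (γ k) (γ i) → 0 ≤ E (γ k) (γ i') := by
  obtain ⟨μ, hμ, hy⟩ : ∃ μ : K, 0 ≤ μ ∧ reflectAlong E (γ i) (ρ b) = γ i + μ • ρ b := by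
    refine ⟨-(E (ρ b) (γ i) / E (ρ b) (ρ b)), ?_, ?_⟩
    · exact neg_nonneg.2 (div_nonpos_of_nonpos_of_nonneg (h.ρ_γ_nonpos hb hj hc) (h.ρ_pos hb).le)
    · rw [reflectAlong, hE, zero_add, neg_smul, sub_eq_add_neg]
  have hmem := h.reflect_mem _ (h.γ_mem i) _ (h.ρ_mem b hb)
  rw [hy] at hmem ⊢
  obtain ⟨i', hi', hyi⟩ := h.exists_eq_γ hmem fun a ha => by
    rw [map_add, map_smul, LinearMap.add_apply, LinearMap.smul_apply, smul_eq_mul]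
    have := h.coef_nonneg i hi a ha
    have := h.ρ_nonneg hb ha
    positivity
  refine ⟨i', hi', hyi, fun k hk hki => ?_⟩
  rw [hyi, map_add, map_smul, smul_eq_mul]
  have := h.coef_nonneg k hk b hb
  positivity

theorem exists_isLeftMutation_add (h : IsSortedRootSequence E Φ c n N ρ γ)
    (hG : IsExceptional E η U G) (hl : n + l ∈ G) (hmax : ∀ g ∈ G, g ≤ n + l)
    (hcon : ¬CanExchange E η U G (n + l)) {a : ℕ} (ha : a ≤ l) :
    ∃ x, l ≤ x ∧ x < a + N ∧ IsLeftMutation E η U G (n + l) (n + a) (γ x) := by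
  have hN : 0 < N := by
    obtain ⟨i, hi, -⟩ := h.cover _ (h.γ_mem 0)
    omega
  induction ha using Nat.decreasingInduction with
  | self =>
    have hself := IsLeftMutation.self hG hl
    rw [positionVector_add] at hself
    exact ⟨l, le_rfl, by omega, hself⟩
  | of_succ a hal ih =>
    obtain ⟨x, hlx, hxa, hx⟩ := ih
    rw [← Nat.add_assoc] at hx
    have hηa : η (n + a) = γ a := positionVector_add a
    by_cases haG : n + a ∈ G
    · have hE : E (γ x) (γ a) = 0 := hηa ▸ hx.left _ haG (by omega)
      have hxN : x ≠ a + N := by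
        rintro rfl
        rw [h.antiperiodic, map_neg, LinearMap.neg_apply, neg_eq_zero] at hE
        exact (h.γ_pos a).ne' hE
      have hreflect := hx.reflect hG haG (h.positionVector_pos _).ne'
      rw [hηa] at hreflect
      obtain ⟨x', hxx', hx'a, hx' | hx'⟩ := h.exists_reflect_eq (by omega) (by omega) hE
      · exact ⟨x', hlx.trans hxx', hx'a, hx' ▸ hreflect⟩
      · exact ⟨x', hlx.trans hxx', hx'a, hx' ▸ hreflect.neg⟩
    · have hx' := hx.of_notMem haG
      refine ⟨x, hlx, lt_of_le_of_ne (by omega) ?_, hx'⟩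
      rintro rfl
      rw [h.antiperiodic, ← hηa] at hx'
      exact hcon ((neg_neg (η (n + a)) ▸ hx'.neg).canExchange hG hl hmax haG (by omega))

theorem exists_isLeftMutation (h : IsSortedRootSequence E Φ c n N ρ γ)
    (hG : IsExceptional E η U G) (hl : n + l ∈ G) (hmax : ∀ g ∈ G, g ≤ n + l)
    (hcon : ¬CanExchange E η U G (n + l)) {b : ℕ} (hb : b ≤ n) :
    ∃ i < N, IsLeftMutation E η U G (n + l) b (γ i) ∧ ∀ k ≤ l, 0 ≤ E (γ k) (γ i) := by
  obtain ⟨x, hlx, hxN, hx⟩ := h.exists_isLeftMutation_add hG hl hmax hcon l.zero_le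
  rw [zero_add] at hxN
  induction hb using Nat.decreasingInduction with
  | self => exact ⟨x, hxN, hx, fun k hk => h.nonneg k x (by omega) (by omega)⟩
  | of_succ b hbn ih =>
    obtain ⟨i, hi, hγ, hk⟩ := ih
    by_cases hbG : b ∈ G
    · obtain ⟨j, hj, hcj⟩ := h.exists_c_γ_eq hG hl hmax hcon hbn hi hγ
      have hηb : η b = ρ b := positionVector_of_lt hbn
      have hreflect := hγ.reflect hG hbG (h.positionVector_pos b).ne'
      rw [hηb] at hreflect
      obtain ⟨i', hi', hii', hk'⟩ :=
        h.exists_reflect_ρ_eq hbn hi hj hcj (hηb ▸ hγ.left b hbG b.lt_succ_self)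
      exact ⟨i', hi', hii' ▸ hreflect, fun k hkl => hk' k (by omega) (hk k hkl)⟩
    · exact ⟨i, hi, hγ.of_notMem hbG, hk⟩

/-- The two sides of `IsLeftMutation.mul_apply_eq` have opposite signs. -/
theorem apply_eq_zero_of_isLeftMutation [FiniteDimensional K V]
    (h : IsSortedRootSequence E Φ c n N ρ γ) (hG : IsExceptional E η U G) (hl : n + l ∈ G)
    (hmax : ∀ g ∈ G, g ≤ n + l) {i j : ℕ} (hj : j < N) (hcj : c (γ i) = γ j) (hlN : l < N)
    (hγ : IsLeftMutation E η U G (n + l) 0 (γ i)) (hk : ∀ k ≤ l, 0 ≤ E (γ k) (γ i)) {g : ℕ}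
    (hg : g < n + l) (hgU : η g ∈ U) : E (η g) (γ i) = 0 := by
  have hmul := hγ.mul_apply_eq hG (fun i => (h.positionVector_pos i).ne') hl hmax hgU
  have hll := h.γ_pos l
  have hli := hk l le_rfl
  rw [positionVector_add] at hmul
  refine (mul_eq_zero.1 (?_ : E (γ l) (γ l) * E (η g) (γ i) = 0)).resolve_left hll.ne'
  rcases lt_or_ge g n with hgn | hng
  · rw [positionVector_of_lt hgn] at hmul ⊢
    have h1 := mul_nonneg hli (h.coef_nonneg l hlN g hgn)
    have h2 := mul_nonpos_of_nonneg_of_nonpos hll.le (h.ρ_γ_nonpos hgn hj hcj)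
    linarith
  · obtain ⟨g, rfl⟩ := Nat.exists_eq_add_of_le hng
    rw [positionVector_add] at hmul ⊢
    have h1 := mul_nonpos_of_nonneg_of_nonpos hli (h.nonpos (i := g) (j := l) (by omega) (by omega))
    have h2 := mul_nonneg hll.le (hk g (by omega))
    linarith

theorem exchangeProperty [FiniteDimensional K V] (h : IsSortedRootSequence E Φ c n N ρ γ) :
    ExchangeProperty E η := by
  intro U G G' l hG hG' hlG hmax hG'l
  have hη (i : ℕ) := (h.positionVector_pos i).ne'
  rcases lt_or_ge l n with hln | hnl
  · refine absurd (hG'.eq_zero_of_forall_mem hη (f := E (η l)) (fun i hi => ?_) (hG.mem l hlG))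
      (hη l)
    have hil := hG'l i hi
    rw [positionVector_of_lt hln, positionVector_of_lt (hil.trans hln), h.ρ_triangular l hln i hil]
  obtain ⟨l, rfl⟩ := Nat.exists_eq_add_of_le hnl
  by_contra hcon
  obtain ⟨x, hlx, hxN, -⟩ := h.exists_isLeftMutation_add hG hlG hmax hcon l.zero_le
  obtain ⟨i, hi, hγ, hk⟩ := h.exists_isLeftMutation hG hlG hmax hcon n.zero_le
  obtain ⟨j, hj, hcj⟩ := h.exists_c_γ_eq hG hlG hmax hcon n.zero_le hi hγ
  exact (h.γ_pos i).ne' <| hG'.eq_zero_of_forall_mem hη (f := LinearMap.flip E (γ i))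
    (fun g hg => h.apply_eq_zero_of_isLeftMutation hG hlG hmax hj hcj (by omega) hγ hk
      (hG'l g hg) (hG'.mem g hg)) hγ.mem

end IsSortedRootSequence

end SortedRootSequence

/-! ### The geometric representation of a Coxeter group -/

section ReflectionPower

open Polynomial.Chebyshev

theorem eval_S_two_mul_cos {φ : ℝ} (hφ : Real.sin φ ≠ 0) (k : ℤ) :
    (S ℝ k).eval (2 * Real.cos φ) = Real.sin ((k + 1) * φ) / Real.sin φ := by
  rw [eq_div_iff hφ, S_two_mul_real_cos]

variable {V : Type*} [AddCommGroup V] [Module ℝ V] {f g : Module.Dual ℝ V} {x y : V}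

theorem reflection_mul_reflection_pow_eq_one {m : ℕ} (hf : f x = 2) (hg : g y = 2) (hm : 3 ≤ m)
    (hfg : f y * g x = 2 * Real.cos (2 * Real.pi / m) + 2) :
    (Module.reflection hf * Module.reflection hg) ^ m = 1 := by
  set φ := 2 * Real.pi / m with hφ
  have hm3 : (3 : ℝ) ≤ m := by exact_mod_cast hm
  have hmφ : m * φ = 2 * Real.pi := mul_div_cancel₀ _ (by positivity)
  have hsin : Real.sin φ ≠ 0 := by
    refine (Real.sin_pos_of_pos_of_lt_pi (by positivity) ?_).ne'
    nlinarith [Real.pi_pos]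
  ext1 z
  rw [Module.reflection_mul_reflection_pow_apply hf hg m z (2 * Real.cos φ) (by linarith)]
  rcases Nat.even_or_odd' m with ⟨k, rfl | rfl⟩ <;> push_cast at hmφ ⊢
  · have hS : (S ℝ ((k : ℤ) - 1)).eval (2 * Real.cos φ) = 0 := by
      rw [eval_S_two_mul_cos hsin]
      push_cast
      rw [sub_add_cancel, show k * φ = Real.pi by linarith, Real.sin_pi, zero_div]
    rw [show (2 * (k : ℤ) - 2) / 2 = k - 1 by omega, show (2 * (k : ℤ) - 1) / 2 = k - 1 by omega,
      hS]
    simp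
  · have hS : (S ℝ (k : ℤ)).eval (2 * Real.cos φ) +
        (S ℝ ((k : ℤ) - 1)).eval (2 * Real.cos φ) = 0 := by
      rw [eval_S_two_mul_cos hsin, eval_S_two_mul_cos hsin, ← add_div]
      push_cast
      rw [sub_add_cancel, show (k + 1) * φ = 2 * Real.pi - k * φ by linarith,
        Real.sin_two_pi_sub, neg_add_cancel, zero_div]
    rw [show (2 * (k : ℤ) + 1 - 2) / 2 = k - 1 by omega,
      show (2 * (k : ℤ) + 1 - 1) / 2 = k by omega,
      show (2 * (k : ℤ) + 1 - 3) / 2 = k - 1 by omega,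
      show (2 * (k : ℤ) + 1) / 2 = k by omega, hS]
    simp

theorem reflection_mul_reflection_sq_eq_one (hf : f x = 2) (hg : g y = 2) (hfy : f y = 0)
    (hgx : g x = 0) : (Module.reflection hf * Module.reflection hg) ^ 2 = 1 := by
  ext1 z
  simp only [sq, LinearEquiv.mul_apply, Module.reflection_apply, map_sub, map_smul, hf, hg, hfy,
    hgx, LinearEquiv.coe_one, id]
  module

end ReflectionPower

section CoxeterMatrix

variable {B : Type*} (M : CoxeterMatrix B)

/-- The entries `-cos (π / m_ij)` of the canonical bilinear form. For `m_ij = ∞`, encoded as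
`M i j = 0`, division by zero gives the correct value `-1`. -/
noncomputable def cosForm (i j : B) : ℝ := -Real.cos (Real.pi / M i j)

theorem cosForm_self (i : B) : cosForm M i i = 1 := by simp [cosForm]

theorem cosForm_comm (i j : B) : cosForm M i j = cosForm M j i := by
  rw [cosForm, cosForm, M.symmetric]

theorem two_le_of_ne {M : CoxeterMatrix B} {i j : B} (hij : i ≠ j) (h0 : M i j ≠ 0) :
    2 ≤ M i j := by
  have := M.off_diagonal i j hij
  omega

open Polynomial.Chebyshev in
theorem eval_S_cosForm_nonneg {i j : B} (hij : i ≠ j) {k : ℤ} (hk : 0 ≤ k + 1)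
    (hkM : M i j = 0 ∨ k + 1 ≤ M i j) : 0 ≤ (S ℝ k).eval (-2 * cosForm M i j) := by
  rw [cosForm, neg_mul_neg]
  by_cases h0 : M i j = 0
  · rw [h0, Nat.cast_zero, div_zero, Real.cos_zero, mul_one, S_eval_two]
    exact_mod_cast hk
  have hm : (2 : ℝ) ≤ M i j := by exact_mod_cast two_le_of_ne hij h0
  have hkR : (0 : ℝ) ≤ k + 1 := by exact_mod_cast hk
  have hkMR : (k + 1 : ℝ) ≤ M i j := by exact_mod_cast hkM.resolve_left h0
  have hpi := Real.pi_pos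
  have hsin : 0 < Real.sin (Real.pi / M i j) :=
    Real.sin_pos_of_pos_of_lt_pi (by positivity) (div_lt_self hpi (by linarith))
  rw [eval_S_two_mul_cos hsin.ne']
  refine div_nonneg (Real.sin_nonneg_of_nonneg_of_le_pi (by positivity) ?_) hsin.le
  rw [mul_div_assoc', div_le_iff₀ (by linarith), mul_comm]
  exact mul_le_mul_of_nonneg_left hkMR hpi.le

/-- The simple root with index `i`. -/
def simpleRoot [DecidableEq B] (i : B) : B → ℝ := Pi.single i 1

theorem simpleRoot_nonneg [DecidableEq B] (i : B) : 0 ≤ simpleRoot i :=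
  Pi.single_nonneg.2 zero_le_one

variable [DecidableEq B]

theorem linearMap_ext_simpleRoot [Finite B] {V : Type*} [AddCommGroup V] [Module ℝ V]
    {f g : (B → ℝ) →ₗ[ℝ] V} (h : ∀ i, f (simpleRoot i) = g (simpleRoot i)) : f = g :=
  LinearMap.pi_ext' fun i => LinearMap.ext_ring (h i)

variable [Fintype B]

/-- Twice the canonical bilinear form. With this normalization every root `β` satisfies
`canonicalForm M β β = 2`, so that `canonicalForm M β` is its coroot. -/
noncomputable def canonicalForm : LinearMap.BilinForm ℝ (B → ℝ) :=
  Matrix.toBilin' (Matrix.of fun i j => 2 * cosForm M i j)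

theorem canonicalForm_simpleRoot (i j : B) :
    canonicalForm M (simpleRoot i) (simpleRoot j) = 2 * cosForm M i j := by
  rw [canonicalForm, simpleRoot, simpleRoot, Matrix.toBilin'_single, Matrix.of_apply]

theorem canonicalForm_simpleRoot_self (i : B) :
    canonicalForm M (simpleRoot i) (simpleRoot i) = 2 := by
  rw [canonicalForm_simpleRoot, cosForm_self, mul_one]

theorem canonicalForm_comm (x y : B → ℝ) : canonicalForm M x y = canonicalForm M y x := by
  have hflip : canonicalForm M = LinearMap.flip (canonicalForm M) :=
    linearMap_ext_simpleRoot fun i => linearMap_ext_simpleRoot fun j => by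
      rw [LinearMap.flip_apply, canonicalForm_simpleRoot, canonicalForm_simpleRoot, cosForm_comm]
  exact LinearMap.congr_fun₂ hflip x y

/-- The reflection of `B → ℝ` attached to the simple root with index `i`. -/
noncomputable def simpleReflection (i : B) : (B → ℝ) ≃ₗ[ℝ] (B → ℝ) :=
  Module.reflection (canonicalForm_simpleRoot_self M i)

theorem isLiftable_simpleReflection : M.IsLiftable (simpleReflection M) := by
  intro i j
  rcases eq_or_ne i j with rfl | hij
  · ext1 x
    rw [M.diagonal, pow_one]
    exact Module.involutive_reflection (canonicalForm_simpleRoot_self M i) x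
  by_cases h0 : M i j = 0
  · rw [h0, pow_zero]
  rcases (two_le_of_ne hij h0).eq_or_lt with h2 | h3
  · have hcos : cosForm M i j = 0 := by simp [cosForm, ← h2]
    rw [← h2]
    exact reflection_mul_reflection_sq_eq_one _ _
      (by rw [canonicalForm_simpleRoot, hcos, mul_zero])
      (by rw [canonicalForm_simpleRoot, cosForm_comm, hcos, mul_zero])
  · refine reflection_mul_reflection_pow_eq_one _ _ h3 ?_
    rw [canonicalForm_simpleRoot, canonicalForm_simpleRoot, cosForm_comm M j i, cosForm,
      mul_div_assoc, Real.cos_two_mul]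
    ring

end CoxeterMatrix

section GeometricRepresentation

variable {B W : Type*} [Group W] {M : CoxeterMatrix B} (cs : CoxeterSystem M W)

/-- Every element factors through the minimal representative of its coset modulo the dihedral
subgroup generated by two simple reflections. -/
theorem exists_eq_mul_wordProd_alternatingWord {w : W} {i j : B} (hi : ¬cs.IsRightDescent w i) :
    ∃ (k : ℕ) (v : W), w = v * cs.wordProd (alternatingWord i j k) ∧
      cs.length w = cs.length v + k ∧ ¬cs.IsRightDescent v i ∧ ¬cs.IsRightDescent v j := by
  induction hd : cs.length w using Nat.strong_induction_on generalizing w i j with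
  | _ d ih =>
    by_cases hj : cs.IsRightDescent w j
    · have hlen := cs.isRightDescent_iff.1 hj
      obtain ⟨k, v, hv, hvlen, hvj, hvi⟩ := ih _ (by omega)
        (cs.isRightDescent_iff_not_isRightDescent_mul.1 hj) (j := i) rfl
      refine ⟨k + 1, v, ?_, by omega, hvi, hvj⟩
      rw [alternatingWord_succ, wordProd_concat, ← mul_assoc, ← hv,
        simple_mul_simple_cancel_right]
    · exact ⟨0, w, by simp [alternatingWord], by simp [hd], hi, hj⟩

theorem le_of_length_mul_wordProd_alternatingWord {v : W} {i j : B} {k : ℕ}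
    (hlen : cs.length (v * cs.wordProd (alternatingWord i j k)) = cs.length v + k)
    (hi : ¬cs.IsRightDescent (v * cs.wordProd (alternatingWord i j k)) i) :
    M i j = 0 ∨ k + 1 ≤ M i j := by
  have hred : cs.IsReduced (alternatingWord j i (k + 1)) := by
    have hlen' := cs.not_isRightDescent_iff.1 hi
    have hle := cs.length_wordProd_le (alternatingWord j i (k + 1))
    have hmul := cs.length_mul_le v (cs.wordProd (alternatingWord j i (k + 1)))
    rw [alternatingWord_succ, wordProd_concat, ← mul_assoc, hlen', hlen] at hmul
    rw [CoxeterSystem.IsReduced]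
    rw [length_alternatingWord] at hle ⊢
    rw [alternatingWord_succ, wordProd_concat] at hle ⊢
    omega
  rw [M.symmetric]
  by_contra! hlt
  exact cs.not_isReduced_alternatingWord j i hlt.1 hlt.2 hred

variable [Fintype B] [DecidableEq B]

/-- The geometric representation of a Coxeter group. -/
noncomputable def geomRep : W →* ((B → ℝ) ≃ₗ[ℝ] (B → ℝ)) :=
  cs.lift ⟨simpleReflection M, isLiftable_simpleReflection M⟩

theorem geomRep_simple (i : B) (x : B → ℝ) :
    geomRep cs (cs.simple i) x = x - canonicalForm M (simpleRoot i) x • simpleRoot i := by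
  rw [geomRep, cs.lift_apply_simple, simpleReflection, Module.reflection_apply]

theorem geomRep_mul (v w : W) (x : B → ℝ) :
    geomRep cs (v * w) x = geomRep cs v (geomRep cs w x) := by
  rw [map_mul, LinearEquiv.mul_apply]

theorem geomRep_one (x : B → ℝ) : geomRep cs 1 x = x := by
  rw [map_one, LinearEquiv.coe_one, id]

theorem geomRep_inv_apply_self (w : W) (x : B → ℝ) :
    geomRep cs w⁻¹ (geomRep cs w x) = x := by
  rw [← geomRep_mul, inv_mul_cancel, geomRep_one]

theorem geomRep_apply_inv_self (w : W) (x : B → ℝ) :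
    geomRep cs w (geomRep cs w⁻¹ x) = x := by
  rw [← geomRep_mul, mul_inv_cancel, geomRep_one]

theorem canonicalForm_geomRep (w : W) (x y : B → ℝ) :
    canonicalForm M (geomRep cs w x) (geomRep cs w y) = canonicalForm M x y := by
  induction w using cs.simple_induction_left with
  | one => rw [geomRep_one, geomRep_one]
  | mul_simple_left w i ih =>
    rw [← ih, geomRep_mul, geomRep_mul, geomRep_simple, geomRep_simple]
    simp only [map_sub, map_smul, LinearMap.sub_apply, LinearMap.smul_apply, smul_eq_mul,
      canonicalForm_simpleRoot_self, canonicalForm_comm M _ (simpleRoot i)]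
    ring

theorem canonicalForm_geomRep_left (w : W) (x y : B → ℝ) :
    canonicalForm M (geomRep cs w x) y = canonicalForm M x (geomRep cs w⁻¹ y) := by
  rw [← canonicalForm_geomRep cs w x, geomRep_apply_inv_self]

theorem geomRep_simple_self (i : B) :
    geomRep cs (cs.simple i) (simpleRoot i) = -simpleRoot i := by
  rw [geomRep_simple, canonicalForm_simpleRoot_self]
  module

open Polynomial.Chebyshev in
theorem geomRep_alternatingWord (i j : B) (k : ℕ) :
    geomRep cs (cs.wordProd (alternatingWord i j k)) (simpleRoot i) =
      if Even k then
        (S ℝ k).eval (-2 * cosForm M i j) • simpleRoot i +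
          (S ℝ (k - 1)).eval (-2 * cosForm M i j) • simpleRoot j
      else (S ℝ (k - 1)).eval (-2 * cosForm M i j) • simpleRoot i +
          (S ℝ k).eval (-2 * cosForm M i j) • simpleRoot j := by
  induction k with
  | zero => simp [alternatingWord]
  | succ k ih =>
    have hS : (S ℝ (k + 1)).eval (-2 * cosForm M i j) =
        -2 * cosForm M i j * (S ℝ k).eval (-2 * cosForm M i j) -
          (S ℝ (k - 1)).eval (-2 * cosForm M i j) := by
      simp [S_add_one]
    rw [alternatingWord_succ', wordProd_cons, geomRep_mul, ih]
    push_cast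
    rw [add_sub_cancel_right, hS]
    by_cases hk : Even k
    · rw [if_pos hk, if_pos hk, if_neg (by simpa [Nat.even_add_one] using hk), geomRep_simple]
      simp only [map_add, map_smul, canonicalForm_simpleRoot, cosForm_self, cosForm_comm M j i,
        smul_eq_mul]
      module
    · rw [if_neg hk, if_neg hk, if_pos (by simpa [Nat.even_add_one] using hk), geomRep_simple]
      simp only [map_add, map_smul, canonicalForm_simpleRoot, cosForm_self, smul_eq_mul]
      module

theorem geomRep_simpleRoot_nonneg {w : W} {i : B} (hi : ¬cs.IsRightDescent w i) :
    0 ≤ geomRep cs w (simpleRoot i) := by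
  induction hd : cs.length w using Nat.strong_induction_on generalizing w i with
  | _ d ih =>
    by_cases hw : w = 1
    · rw [hw, geomRep_one]
      exact simpleRoot_nonneg i
    obtain ⟨j, hj⟩ := cs.exists_rightDescent_of_ne_one hw
    have hij : i ≠ j := fun h => hi (h ▸ hj)
    obtain ⟨k, v, rfl, hlen, hvi, hvj⟩ := exists_eq_mul_wordProd_alternatingWord cs (j := j) hi
    have hk : k ≠ 0 := fun hk => hvj (by simpa [hk, alternatingWord] using hj)
    have hkM := le_of_length_mul_wordProd_alternatingWord cs hlen hi
    have hi_nonneg := ih _ (by omega) hvi rfl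
    have hj_nonneg := ih _ (by omega) hvj rfl
    have hS := eval_S_cosForm_nonneg M hij (k := k) (by omega) (by omega)
    have hS' := eval_S_cosForm_nonneg M hij (k := k - 1) (by omega) (by omega)
    rw [geomRep_mul, geomRep_alternatingWord]
    split_ifs <;> rw [map_add, map_smul, map_smul]
    · exact add_nonneg (smul_nonneg hS hi_nonneg) (smul_nonneg hS' hj_nonneg)
    · exact add_nonneg (smul_nonneg hS' hi_nonneg) (smul_nonneg hS hj_nonneg)

theorem geomRep_simpleRoot_nonpos {w : W} {i : B} (hi : cs.IsRightDescent w i) :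
    geomRep cs w (simpleRoot i) ≤ 0 := by
  have hnonneg := geomRep_simpleRoot_nonneg cs (cs.isRightDescent_iff_not_isRightDescent_mul.1 hi)
  rwa [geomRep_mul, geomRep_simple_self, map_neg, Left.nonneg_neg_iff] at hnonneg

end GeometricRepresentation

/-! ### Roots -/

section Roots

variable {B W : Type*} [Group W] {M : CoxeterMatrix B} [Fintype B] [DecidableEq B]
  {cs : CoxeterSystem M W}

variable (cs) in
/-- The roots of a Coxeter system. -/
def rootSet : Set (B → ℝ) := {x | ∃ w i, geomRep cs w (simpleRoot i) = x}

variable (cs) in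
theorem geomRep_simpleRoot_mem (w : W) (i : B) : geomRep cs w (simpleRoot i) ∈ rootSet cs :=
  ⟨w, i, rfl⟩

variable (cs) in
theorem simpleRoot_mem (i : B) : simpleRoot i ∈ rootSet cs := ⟨1, i, geomRep_one cs _⟩

theorem geomRep_mem (w : W) {x : B → ℝ} (hx : x ∈ rootSet cs) : geomRep cs w x ∈ rootSet cs := by
  obtain ⟨v, i, rfl⟩ := hx
  exact ⟨w * v, i, geomRep_mul cs _ _ _⟩

theorem neg_mem_rootSet {x : B → ℝ} (hx : x ∈ rootSet cs) : -x ∈ rootSet cs := by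
  obtain ⟨v, i, rfl⟩ := hx
  exact ⟨v * cs.simple i, i, by rw [geomRep_mul, geomRep_simple_self, map_neg]⟩

variable (cs) in
theorem finite_rootSet [Finite W] : (rootSet cs).Finite := by
  have hrange : rootSet cs = Set.range fun p : W × B => geomRep cs p.1 (simpleRoot p.2) := by
    ext x
    simp [rootSet]
  exact hrange ▸ Set.finite_range _

theorem canonicalForm_self_of_mem_rootSet {x : B → ℝ} (hx : x ∈ rootSet cs) :
    canonicalForm M x x = 2 := by
  obtain ⟨v, i, rfl⟩ := hx
  rw [canonicalForm_geomRep, canonicalForm_simpleRoot_self]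

theorem ne_zero_of_mem_rootSet {x : B → ℝ} (hx : x ∈ rootSet cs) : x ≠ 0 := by
  rintro rfl
  simpa using canonicalForm_self_of_mem_rootSet hx

theorem nonneg_or_nonpos_of_mem_rootSet {x : B → ℝ} (hx : x ∈ rootSet cs) : 0 ≤ x ∨ x ≤ 0 := by
  obtain ⟨v, i, rfl⟩ := hx
  by_cases h : cs.IsRightDescent v i
  · exact Or.inr (geomRep_simpleRoot_nonpos cs h)
  · exact Or.inl (geomRep_simpleRoot_nonneg cs h)

theorem not_nonpos_of_nonneg {x : B → ℝ} (hx : x ∈ rootSet cs) (h : 0 ≤ x) : ¬x ≤ 0 :=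
  fun h' => ne_zero_of_mem_rootSet hx (le_antisymm h' h)

theorem not_nonneg_iff_nonpos {x : B → ℝ} (hx : x ∈ rootSet cs) : ¬0 ≤ x ↔ x ≤ 0 :=
  ⟨(nonneg_or_nonpos_of_mem_rootSet hx).resolve_left,
    fun hnonpos hnonneg => not_nonpos_of_nonneg hx hnonneg hnonpos⟩

theorem not_isRightDescent_iff_nonneg {w : W} {i : B} :
    ¬cs.IsRightDescent w i ↔ 0 ≤ geomRep cs w (simpleRoot i) :=
  ⟨geomRep_simpleRoot_nonneg cs, fun h hdesc =>
    not_nonpos_of_nonneg (geomRep_simpleRoot_mem cs w i) h (geomRep_simpleRoot_nonpos cs hdesc)⟩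

theorem isRightDescent_iff_nonpos {w : W} {i : B} :
    cs.IsRightDescent w i ↔ geomRep cs w (simpleRoot i) ≤ 0 := by
  rw [← not_nonneg_iff_nonpos (geomRep_simpleRoot_mem cs w i), ← not_isRightDescent_iff_nonneg,
    not_not]

theorem eq_one_of_forall_nonneg {w : W} (h : ∀ i, 0 ≤ geomRep cs w (simpleRoot i)) : w = 1 := by
  by_contra hw
  obtain ⟨i, hi⟩ := cs.exists_rightDescent_of_ne_one hw
  exact not_isRightDescent_iff_nonneg.2 (h i) hi

variable (cs) in
theorem geomRep_injective : Function.Injective (geomRep cs) := by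
  rw [injective_iff_map_eq_one]
  intro w hw
  refine eq_one_of_forall_nonneg (cs := cs) fun i => ?_
  rw [hw]
  exact simpleRoot_nonneg i

theorem eq_simpleRoot_of_mem_rootSet {x : B → ℝ} (hx : x ∈ rootSet cs) (h : 0 ≤ x) {i : B}
    (hi : ∀ j ≠ i, x j = 0) : x = simpleRoot i := by
  have hxi : x = x i • simpleRoot i := by
    ext j
    by_cases hj : j = i
    · simp [hj, simpleRoot]
    · simp [simpleRoot, hi j hj, hj]
  have hself := canonicalForm_self_of_mem_rootSet hx
  rw [hxi] at hself
  simp only [map_smul, LinearMap.smul_apply, canonicalForm_simpleRoot_self, smul_eq_mul] at hself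
  have hone : x i = 1 := by nlinarith [show 0 ≤ x i from h i]
  rw [hxi, hone, one_smul]

theorem geomRep_simple_nonneg {x : B → ℝ} (hx : x ∈ rootSet cs) (h : 0 ≤ x) {i : B}
    (hxi : x ≠ simpleRoot i) : 0 ≤ geomRep cs (cs.simple i) x := by
  obtain ⟨j, hji, hj⟩ : ∃ j, j ≠ i ∧ x j ≠ 0 := by
    by_contra! hsupp
    exact hxi (eq_simpleRoot_of_mem_rootSet hx h hsupp)
  refine (nonneg_or_nonpos_of_mem_rootSet (geomRep_mem _ hx)).resolve_right fun hnonpos => hj ?_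
  have hxj := hnonpos j
  rw [geomRep_simple, Pi.sub_apply, Pi.smul_apply, simpleRoot, Pi.single_eq_of_ne hji, smul_zero,
    sub_zero] at hxj
  exact le_antisymm hxj (h j)

end Roots

section Reflections

variable {B W : Type*} [Group W] {M : CoxeterMatrix B} [Fintype B] [DecidableEq B]
  {cs : CoxeterSystem M W}

variable (cs) in
/-- The element `t` acts on the geometric representation as the orthogonal reflection along the
vector `β`, which is normalized as the roots are. -/
structure IsReflectionAlong (t : W) (β : B → ℝ) : Prop where
  canonicalForm_self : canonicalForm M β β = 2
  apply_eq : ∀ x, geomRep cs t x = x - canonicalForm M x β • β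

theorem IsReflectionAlong.ne_zero {t : W} {β : B → ℝ} (h : IsReflectionAlong cs t β) : β ≠ 0 := by
  rintro rfl
  simpa using h.canonicalForm_self

variable (cs) in
theorem isReflectionAlong_simple (i : B) : IsReflectionAlong cs (cs.simple i) (simpleRoot i) :=
  ⟨canonicalForm_simpleRoot_self M i, fun x => by rw [geomRep_simple, canonicalForm_comm]⟩

theorem IsReflectionAlong.conj {t : W} {β : B → ℝ} (h : IsReflectionAlong cs t β) (w : W) :
    IsReflectionAlong cs (w * t * w⁻¹) (geomRep cs w β) where
  canonicalForm_self := by rw [canonicalForm_geomRep, h.canonicalForm_self]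
  apply_eq x := by
    rw [geomRep_mul, geomRep_mul, h.apply_eq, map_sub, map_smul, geomRep_apply_inv_self,
      canonicalForm_geomRep_left, inv_inv]

theorem IsReflectionAlong.neg {t : W} {β : B → ℝ} (h : IsReflectionAlong cs t β) :
    IsReflectionAlong cs t (-β) where
  canonicalForm_self := by
    rw [map_neg, map_neg, LinearMap.neg_apply, neg_neg, h.canonicalForm_self]
  apply_eq x := by rw [h.apply_eq, map_neg, neg_smul_neg]

theorem IsReflectionAlong.unique {t t' : W} {β : B → ℝ} (h : IsReflectionAlong cs t β)
    (h' : IsReflectionAlong cs t' β) : t = t' := by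
  apply geomRep_injective cs
  ext1 x
  rw [h.apply_eq, h'.apply_eq]

theorem IsReflectionAlong.inv_eq {t : W} {β : B → ℝ} (h : IsReflectionAlong cs t β) :
    t⁻¹ = t := by
  rw [inv_eq_iff_mul_eq_one]
  apply geomRep_injective cs
  ext1 x
  rw [geomRep_mul, h.apply_eq, h.apply_eq, map_one, LinearEquiv.coe_one, id]
  simp only [map_sub, map_smul, LinearMap.sub_apply, LinearMap.smul_apply, smul_eq_mul,
    h.canonicalForm_self]
  module

variable (cs) in
theorem isReflectionAlong_geomRep (w : W) (i : B) :
    IsReflectionAlong cs (w * cs.simple i * w⁻¹) (geomRep cs w (simpleRoot i)) :=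
  (isReflectionAlong_simple cs i).conj w

end Reflections

section PositiveDefinite

theorem exists_invariant_bilinForm {G ι : Type*} [Group G] [Finite G] [Finite ι]
    (ρ : G →* ((ι → ℝ) ≃ₗ[ℝ] (ι → ℝ))) :
    ∃ b : LinearMap.BilinForm ℝ (ι → ℝ), (∀ x y, b x y = b y x) ∧ (∀ x ≠ 0, 0 < b x x) ∧
      ∀ g x y, b (ρ g x) (ρ g y) = b x y := by
  have := Fintype.ofFinite G
  have := Fintype.ofFinite ι
  let b : LinearMap.BilinForm ℝ (ι → ℝ) :=
    ∑ g : G, (dotProductBilin ℝ ℝ).compl₁₂ (ρ g).toLinearMap (ρ g).toLinearMap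
  have hb (x y : ι → ℝ) : b x y = ∑ g : G, ρ g x ⬝ᵥ ρ g y := by
    simp only [b, LinearMap.sum_apply]
    rfl
  refine ⟨b, fun x y => by simp only [hb, dotProduct_comm], fun x hx => ?_, fun g x y => ?_⟩
  · rw [hb]
    refine Finset.sum_pos (fun g _ => ?_) ⟨1, Finset.mem_univ _⟩
    have hgx : ρ g x ≠ 0 := by rwa [Ne, LinearEquiv.map_eq_zero_iff]
    exact (Finset.sum_nonneg fun i _ => mul_self_nonneg _).lt_of_ne'
      fun h => hgx (dotProduct_self_eq_zero.1 h)
  · rw [hb, hb]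
    exact Fintype.sum_equiv (Equiv.mulRight g) _ _ fun k => by
      rw [Equiv.coe_mulRight, map_mul, LinearEquiv.mul_apply, LinearEquiv.mul_apply]

variable {B W : Type*} [Group W] {M : CoxeterMatrix B} [Fintype B] [DecidableEq B]

theorem exists_cosForm_eq_of_invariant (cs : CoxeterSystem M W)
    {b : LinearMap.BilinForm ℝ (B → ℝ)} (b_comm : ∀ x y, b x y = b y x)
    (b_pos : ∀ i, 0 < b (simpleRoot i) (simpleRoot i))
    (b_geomRep : ∀ w x y, b (geomRep cs w x) (geomRep cs w y) = b x y) :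
    ∃ e : B → ℝ, (∀ i, 0 < e i) ∧
      ∀ i j, cosForm M i j = e i * e j * b (simpleRoot i) (simpleRoot j) := by
  set d : B → ℝ := fun i => b (simpleRoot i) (simpleRoot i)
  set e : B → ℝ := fun i => (√(d i))⁻¹ with he
  have e_sq (i : B) : d i * (e i * e i) = 1 := by
    rw [he, ← mul_inv, Real.mul_self_sqrt (b_pos i).le, mul_inv_cancel₀ (b_pos i).ne']
  have b_simpleRoot (i j : B) : b (simpleRoot i) (simpleRoot j) = cosForm M i j * d i := by
    have h := b_geomRep (cs.simple i) (simpleRoot i) (simpleRoot j)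
    rw [geomRep_simple_self, geomRep_simple, canonicalForm_simpleRoot, map_neg, map_sub, map_smul,
      LinearMap.neg_apply, LinearMap.neg_apply, smul_eq_mul] at h
    linarith
  refine ⟨e, fun i => inv_pos.2 (Real.sqrt_pos.2 (b_pos i)), fun i j => ?_⟩
  rcases eq_or_ne (cosForm M i j) 0 with h0 | h0
  · rw [b_simpleRoot, h0, zero_mul, mul_zero]
  -- Symmetry of `b` forces joined simple roots to have equal lengths.
  have hij : d i = d j := by
    have hji := b_simpleRoot j i
    rw [b_comm, b_simpleRoot, cosForm_comm M j i] at hji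
    exact mul_left_cancel₀ h0 hji
  have heij : e i = e j := by simp only [he, hij]
  rw [b_simpleRoot]
  linear_combination d i * cosForm M i j * e i * heij - cosForm M i j * e_sq i

theorem canonicalForm_pos [Finite W] (cs : CoxeterSystem M W) {x : B → ℝ} (hx : x ≠ 0) :
    0 < canonicalForm M x x := by
  obtain ⟨b, b_comm, b_pos, b_geomRep⟩ := exists_invariant_bilinForm (geomRep cs)
  obtain ⟨e, e_pos, he⟩ := exists_cosForm_eq_of_invariant cs b_comm
    (fun i => b_pos _ (ne_zero_of_mem_rootSet (simpleRoot_mem cs i))) b_geomRep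
  have mulLeft_simpleRoot (i : B) : LinearMap.mulLeft ℝ e (simpleRoot i) = e i • simpleRoot i := by
    ext j
    rcases eq_or_ne j i with rfl | hji
    · simp [simpleRoot]
    · simp [simpleRoot, hji]
  have hform : canonicalForm M =
      (2 : ℝ) • b.compl₁₂ (LinearMap.mulLeft ℝ e) (LinearMap.mulLeft ℝ e) := by
    refine linearMap_ext_simpleRoot fun i => linearMap_ext_simpleRoot fun j => ?_
    simp only [canonicalForm_simpleRoot, LinearMap.smul_apply, LinearMap.compl₁₂_apply,
      mulLeft_simpleRoot, map_smul, smul_eq_mul, he]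
    ring
  have hex : LinearMap.mulLeft ℝ e x ≠ 0 := fun h =>
    hx (funext fun i => (mul_eq_zero.1 (congrFun h i)).resolve_left (e_pos i).ne')
  rw [hform]
  exact mul_pos two_pos (b_pos _ hex)

end PositiveDefinite

section Longest

variable {B W : Type*} [Group W] [Finite W] {M : CoxeterMatrix B} (cs : CoxeterSystem M W)

theorem length_le_length_longest (w : W) : cs.length w ≤ cs.length cs.longest :=
  (Finite.exists_max cs.length).choose_spec w

theorem isRightDescent_longest (i : B) : cs.IsRightDescent cs.longest i := by
  by_contra h
  have hlt := cs.not_isRightDescent_iff.1 h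
  have hle := length_le_length_longest cs (cs.longest * cs.simple i)
  omega

theorem geomRep_longest_nonpos [Fintype B] [DecidableEq B] {x : B → ℝ} (hx : 0 ≤ x) :
    geomRep cs cs.longest x ≤ 0 := by
  have hsum : x = ∑ i, x i • simpleRoot i := pi_eq_sum_univ' x
  rw [hsum, map_sum]
  refine Finset.sum_nonpos fun i _ => ?_
  rw [map_smul]
  exact smul_nonpos_of_nonneg_of_nonpos (hx i)
    (geomRep_simpleRoot_nonpos cs (isRightDescent_longest cs i))

variable [Finite B]

theorem length_longest_mul_add (w : W) :
    cs.length (cs.longest * w) + cs.length w = cs.length cs.longest := by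
  classical
  have := Fintype.ofFinite B
  induction hd : cs.length w generalizing w with
  | zero => rw [cs.length_eq_zero_iff.1 hd, mul_one, add_zero]
  | succ d ih =>
    obtain ⟨i, hi⟩ := cs.exists_rightDescent_of_ne_one (w := w) fun h => by simp [h] at hd
    have hlen := cs.isRightDescent_iff.1 hi
    have hdesc : cs.IsRightDescent (cs.longest * (w * cs.simple i)) i := by
      rw [isRightDescent_iff_nonpos, geomRep_mul]
      exact geomRep_longest_nonpos cs
        (geomRep_simpleRoot_nonneg cs (cs.isRightDescent_iff_not_isRightDescent_mul.1 hi))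
    have hlen' := cs.isRightDescent_iff.1 hdesc
    have hih := ih (w * cs.simple i) (by omega)
    rw [mul_assoc, simple_mul_simple_cancel_right] at hlen'
    omega

theorem longest_mul_longest : cs.longest * cs.longest = 1 := by
  have := length_longest_mul_add cs cs.longest
  exact cs.length_eq_zero_iff.1 (by omega)

theorem eq_longest_of_forall_isRightDescent {v : W} (h : ∀ i, cs.IsRightDescent v i) :
    v = cs.longest := by
  classical
  have := Fintype.ofFinite B
  have hone : cs.longest * v = 1 := by
    refine eq_one_of_forall_nonneg (cs := cs) fun i => ?_
    rw [geomRep_mul, ← neg_neg (geomRep cs v _), map_neg]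
    exact neg_nonneg.2 (geomRep_longest_nonpos cs
      (neg_nonneg.2 (geomRep_simpleRoot_nonpos cs (h i))))
  rw [← mul_right_inj cs.longest, hone, longest_mul_longest]

theorem simple_conjLongest (i : B) :
    cs.simple (cs.conjLongest i) = cs.longest * cs.simple i * cs.longest⁻¹ := by
  have hlen := length_longest_mul_add cs (cs.simple i * cs.longest⁻¹)
  have hdesc := cs.isRightDescent_iff.1 (isRightDescent_longest cs i)
  have hinv : cs.length (cs.simple i * cs.longest⁻¹) = cs.length (cs.longest * cs.simple i) := by
    rw [← cs.length_inv, mul_inv_rev, inv_inv, inv_simple]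
  obtain ⟨j, hj⟩ := cs.length_eq_one_iff.1
    (by omega : cs.length (cs.longest * (cs.simple i * cs.longest⁻¹)) = 1)
  have : Nonempty B := ⟨i⟩
  exact Function.invFun_eq ⟨j, by rw [← hj, mul_assoc]⟩

end Longest

/-! ### Products of reflections and triangular Gram matrices -/

section ReflectionProducts

variable {K V : Type*} [Field K] [AddCommGroup V] [Module K V] (E : LinearMap.BilinForm K V)

theorem sub_reflectAlong (x g : V) :
    x - reflectAlong E x g = ((E x g + E g x) / E g g) • g := sub_sub_cancel _ _

theorem apply_sub_foldl_reflectAlong_eq_zero {l : List V} {y : V} (h : ∀ g ∈ l, E g y = 0)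
    (x : V) : E (x - l.foldl (reflectAlong E) x) y = 0 := by
  induction l generalizing x with
  | nil => simp
  | cons g l ih =>
    rw [List.forall_mem_cons] at h
    rw [List.foldl_cons, ← sub_add_sub_cancel x (reflectAlong E x g), map_add,
      LinearMap.add_apply, ih h.2, sub_reflectAlong, map_smul, LinearMap.smul_apply, h.1,
      smul_zero, add_zero]

theorem apply_sub_foldl_reflectAlong {l : List V} (hl : l.Pairwise fun g g' => E g' g = 0)
    (h0 : ∀ g ∈ l, E g g ≠ 0) (x : V) {y : V} (hy : y ∈ l) :
    E (x - l.foldl (reflectAlong E) x) y = E x y + E y x := by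
  induction l generalizing x with
  | nil => simp at hy
  | cons g l ih =>
    obtain ⟨hg, hl⟩ := List.pairwise_cons.1 hl
    rw [List.forall_mem_cons] at h0
    rw [List.foldl_cons, ← sub_add_sub_cancel x (reflectAlong E x g), map_add,
      LinearMap.add_apply]
    rcases List.mem_cons.1 hy with rfl | hy
    · rw [apply_sub_foldl_reflectAlong_eq_zero E hg, sub_reflectAlong, map_smul,
        LinearMap.smul_apply, smul_eq_mul, div_mul_cancel₀ _ h0.1, add_zero]
    · rw [ih hl h0.2 _ hy, sub_reflectAlong]
      simp only [reflectAlong, map_smul, LinearMap.smul_apply, map_sub, LinearMap.sub_apply,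
        hg y hy, smul_zero]
      abel

theorem sub_foldl_reflectAlong_mem_span (l : List V) (x : V) :
    x - l.foldl (reflectAlong E) x ∈ Submodule.span K {v | v ∈ l} := by
  induction l generalizing x with
  | nil => simp
  | cons g l ih =>
    rw [List.foldl_cons, ← sub_add_sub_cancel x (reflectAlong E x g), sub_reflectAlong]
    exact add_mem (Submodule.smul_mem _ _ (Submodule.subset_span List.mem_cons_self))
      (Submodule.span_mono (fun v hv => List.mem_cons_of_mem _ hv) (ih _))

theorem linearIndependent_get_cons_iff {g : V} {l : List V} :
    LinearIndependent K (g :: l).get ↔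
      LinearIndependent K l.get ∧ g ∉ Submodule.span K {v | v ∈ l} := by
  rw [← Set.range_list_get]
  exact linearIndependent_finSucc

theorem symm_apply_eq_zero_of_sub_foldl_mem_span {l₁ l₂ : List V}
    (hli : LinearIndependent K (l₁ ++ l₂).get) (h0 : ∀ g ∈ l₁, E g g ≠ 0) {x : V}
    (hx : x - (l₁ ++ l₂).foldl (reflectAlong E) x ∈ Submodule.span K {v | v ∈ l₂}) :
    ∀ g ∈ l₁, E x g + E g x = 0 := by
  induction l₁ generalizing x with
  | nil => simp
  | cons g l₁ ih =>
    rw [List.forall_mem_cons] at h0 ⊢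
    rw [List.cons_append, linearIndependent_get_cons_iff] at hli
    rw [List.cons_append, List.foldl_cons] at hx
    have hxg : E x g + E g x = 0 := by
      by_contra hne
      have hmem := sub_mem (Submodule.span_mono (t := {v | v ∈ l₁ ++ l₂})
        (fun v hv => List.mem_append_right _ hv) hx)
        (sub_foldl_reflectAlong_mem_span E (l₁ ++ l₂) (reflectAlong E x g))
      rw [sub_sub_sub_cancel_right, sub_reflectAlong] at hmem
      exact hli.2 ((Submodule.smul_mem_iff _ (div_ne_zero hne h0.1)).1 hmem)
    have hfix : reflectAlong E x g = x := by
      rw [reflectAlong, hxg, zero_div, zero_smul, sub_zero]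
    rw [hfix] at hx
    exact ⟨hxg, ih hli.1 h0.2 hx⟩

theorem pairwise_of_foldl_reflectAlong [FiniteDimensional K V] [NeZero (2 : K)]
    (hE : ∀ x ≠ 0, E x x ≠ 0) {l : List V} (hlen : l.length = Module.finrank K V)
    (h0 : ∀ g ∈ l, g ≠ 0) {d : V →ₗ[K] V} (hd : ∀ x, l.foldl (reflectAlong E) x = d x)
    (hdE : ∀ x y, E (x - d x) y = E x y + E y x) : l.Pairwise fun g g' => E g' g = 0 := by
  have hinj : Function.Injective (LinearMap.id - d : V →ₗ[K] V) := by
    rw [injective_iff_map_eq_zero]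
    intro x hx
    have hself := hdE x x
    rw [show x - d x = 0 from hx, map_zero, LinearMap.zero_apply, ← two_mul, eq_comm,
      mul_eq_zero_iff_left two_ne_zero] at hself
    exact not_not.1 fun hne => hE x hne hself
  have hsurj := LinearMap.injective_iff_surjective.1 hinj
  have hli : LinearIndependent K l.get := by
    refine linearIndependent_of_top_le_span_of_card_eq_finrank (fun v _ => ?_) (by simp [hlen])
    obtain ⟨x, rfl⟩ := hsurj v
    have hmem := sub_foldl_reflectAlong_mem_span E l x
    rw [hd] at hmem
    rwa [Set.range_list_get]
  rw [List.pairwise_iff_getElem]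
  intro i j hi hj hij
  obtain ⟨x, hx : x - d x = l[j]⟩ := hsurj l[j]
  have hsplit : l.take j ++ l.drop j = l := List.take_append_drop j l
  have hmem : x - (l.take j ++ l.drop j).foldl (reflectAlong E) x ∈
      Submodule.span K {v | v ∈ l.drop j} := by
    rw [hsplit, hd, hx, List.drop_eq_getElem_cons hj]
    exact Submodule.subset_span List.mem_cons_self
  rw [← hx, hdE]
  exact symm_apply_eq_zero_of_sub_foldl_mem_span E (hsplit.symm ▸ hli)
    (fun g hg => hE g (h0 g (List.mem_of_mem_take hg))) hmem _
    (List.mem_take_iff_getElem.2 ⟨i, by omega, rfl⟩)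

end ReflectionProducts

/-! ### The Euler form of a Coxeter word -/

section EulerForm

theorem pairwise_reverse_idxOf {B : Type*} [DecidableEq B] {c : List B}
    (hc : c.Nodup) :
    c.reverse.Pairwise fun i j => c.idxOf j < c.idxOf i := by
  rw [List.pairwise_reverse, List.pairwise_iff_getElem]
  intro i j hi hj hij
  rwa [hc.idxOf_getElem, hc.idxOf_getElem]

variable {B W : Type*} [Group W] {M : CoxeterMatrix B} [Fintype B] [DecidableEq B]
  (cs : CoxeterSystem M W) {c : List B}

variable (M) in
/-- The bilinear form with symmetrization `canonicalForm M` whose Gram matrix on the simple roots,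
taken in the order of the word `c`, is lower triangular. -/
noncomputable def eulerForm (c : List B) : LinearMap.BilinForm ℝ (B → ℝ) :=
  Matrix.toBilin' (Matrix.of fun i j =>
    if i = j then 1 else if c.idxOf j < c.idxOf i then 2 * cosForm M i j else 0)

theorem eulerForm_simpleRoot (c : List B) (i j : B) :
    eulerForm M c (simpleRoot i) (simpleRoot j) =
      if i = j then 1 else if c.idxOf j < c.idxOf i then 2 * cosForm M i j else 0 := by
  rw [eulerForm, simpleRoot, simpleRoot, Matrix.toBilin'_single, Matrix.of_apply]

theorem eulerForm_add_flip (hc : IsCoxeterWord c) (x y : B → ℝ) :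
    eulerForm M c x y + eulerForm M c y x = canonicalForm M x y := by
  have hform : eulerForm M c + LinearMap.flip (eulerForm M c) = canonicalForm M := by
    refine linearMap_ext_simpleRoot fun i => linearMap_ext_simpleRoot fun j => ?_
    rw [LinearMap.add_apply, LinearMap.add_apply, LinearMap.flip_apply, eulerForm_simpleRoot,
      eulerForm_simpleRoot, canonicalForm_simpleRoot]
    rcases eq_or_ne i j with rfl | hij
    · rw [if_pos rfl, cosForm_self]
      norm_num
    rw [if_neg hij, if_neg hij.symm]
    rcases lt_or_gt_of_ne fun h => hij ((List.idxOf_inj (hc.2 i)).1 h) with h | h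
    · rw [if_neg h.not_gt, if_pos h, zero_add, cosForm_comm]
    · rw [if_pos h, if_neg h.not_gt, add_zero]
  exact LinearMap.congr_fun₂ hform x y

theorem two_mul_eulerForm_self (hc : IsCoxeterWord c) (x : B → ℝ) :
    2 * eulerForm M c x x = canonicalForm M x x := by
  rw [two_mul, eulerForm_add_flip hc]

include cs in
theorem eulerForm_pos [Finite W] (hc : IsCoxeterWord c) {x : B → ℝ} (hx : x ≠ 0) :
    0 < eulerForm M c x x := by
  have := canonicalForm_pos cs hx
  rw [← two_mul_eulerForm_self hc] at this
  linarith

variable {cs}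

theorem IsReflectionAlong.reflectAlong_eq (hc : IsCoxeterWord c) {t : W} {β : B → ℝ}
    (h : IsReflectionAlong cs t β) (x : B → ℝ) :
    reflectAlong (eulerForm M c) x β = geomRep cs t x := by
  have hself := two_mul_eulerForm_self (M := M) hc β
  rw [h.canonicalForm_self, mul_eq_left₀ two_ne_zero] at hself
  rw [h.apply_eq, reflectAlong, eulerForm_add_flip hc, hself, div_one]

theorem foldl_reflectAlong (hc : IsCoxeterWord c) {ι : Type*} (l : List ι) {t : ι → W}
    {β : ι → B → ℝ} (h : ∀ i ∈ l, IsReflectionAlong cs (t i) (β i)) (x : B → ℝ) :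
    (l.map β).foldl (reflectAlong (eulerForm M c)) x = geomRep cs (l.map t).prod⁻¹ x := by
  induction l generalizing x with
  | nil => simp
  | cons i l ih =>
    rw [List.forall_mem_cons] at h
    rw [List.map_cons, List.foldl_cons, h.1.reflectAlong_eq hc, ih h.2, List.map_cons,
      List.prod_cons, mul_inv_rev, geomRep_mul, h.1.inv_eq]

variable (cs) in
theorem eulerForm_sub_wordProd (hc : IsCoxeterWord c) (x y : B → ℝ) :
    eulerForm M c (x - geomRep cs (cs.wordProd c) x) y = canonicalForm M x y := by
  have hfold := foldl_reflectAlong hc c.reverse (fun i _ => isReflectionAlong_simple cs i) x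
  have hprod : (c.reverse.map cs.simple).prod⁻¹ = cs.wordProd c := by
    rw [← inv_inv (cs.wordProd c), ← wordProd_reverse, wordProd]
  have hpairwise : (c.reverse.map simpleRoot).Pairwise fun g g' => eulerForm M c g' g = 0 := by
    rw [List.pairwise_map]
    refine (pairwise_reverse_idxOf hc.1).imp fun {i j} hij => ?_
    rw [eulerForm_simpleRoot, if_neg (fun h => by simp [h] at hij), if_neg hij.not_gt]
  have hself : ∀ g ∈ c.reverse.map (simpleRoot (B := B)), eulerForm M c g g ≠ 0 := by
    simp [eulerForm_simpleRoot]
  rw [hprod] at hfold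
  rw [← hfold]
  refine LinearMap.congr_fun (linearMap_ext_simpleRoot fun i => ?_) y
  rw [apply_sub_foldl_reflectAlong _ hpairwise hself _
    (List.mem_map_of_mem (List.mem_reverse.2 (hc.2 i))), eulerForm_add_flip hc]

variable (cs) in
theorem eulerForm_serre (hc : IsCoxeterWord c) (x y : B → ℝ) :
    eulerForm M c y x = -eulerForm M c (geomRep cs (cs.wordProd c) x) y := by
  have hsub := eulerForm_sub_wordProd cs hc x y
  rw [← eulerForm_add_flip hc, map_sub, LinearMap.sub_apply] at hsub
  linarith

variable (cs) in
theorem eulerForm_wordProd_pow (hc : IsCoxeterWord c) (r : ℕ) (x y : B → ℝ) :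
    eulerForm M c (geomRep cs (cs.wordProd c ^ r) x) (geomRep cs (cs.wordProd c ^ r) y) =
      eulerForm M c x y := by
  have hinv (x y : B → ℝ) : eulerForm M c (geomRep cs (cs.wordProd c) x)
      (geomRep cs (cs.wordProd c) y) = eulerForm M c x y := by
    rw [eulerForm_serre cs hc y x, eulerForm_serre cs hc x, neg_neg]
  induction r with
  | zero => simp
  | succ r ih => rw [pow_succ', geomRep_mul, geomRep_mul, hinv, ih]

end EulerForm

/-! ### The roots of the word `c^∞` -/

section Letters

variable {B W : Type*} [Group W] {M : CoxeterMatrix B} (cs : CoxeterSystem M W) {c : List B}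

/-- The letter at position `k` (counted from `0`) of `c^∞`, for a nonempty word `c`. -/
def cyclicLetter (c : List B) (hn : 0 < c.length) (k : ℕ) : B :=
  getElem c (k % c.length) (Nat.mod_lt _ hn)

theorem infiniteLetter_eq_some (hn : 0 < c.length) (k : ℕ) :
    infiniteLetter c k = some (cyclicLetter c hn k) :=
  List.getElem?_eq_getElem _

theorem cyclicLetter_of_lt (hn : 0 < c.length) {k : ℕ} (hk : k < c.length) :
    cyclicLetter c hn k = getElem c k hk := by
  simp only [cyclicLetter, Nat.mod_eq_of_lt hk]

theorem exists_cyclicLetter_eq (hc : IsCoxeterWord c) (hn : 0 < c.length) (i : B) :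
    ∃ a < c.length, cyclicLetter c hn a = i := by
  obtain ⟨a, ha, rfl⟩ := List.mem_iff_getElem.1 (hc.2 i)
  exact ⟨a, ha, cyclicLetter_of_lt hn ha⟩

theorem cyclicLetter_add_mul (hn : 0 < c.length) (k r : ℕ) :
    cyclicLetter c hn (k + r * c.length) = cyclicLetter c hn k := by
  simp only [cyclicLetter, Nat.add_mul_mod_self_right]

/-- The product of the first `k` letters of `c^∞`. -/
def prefixElement (c : List B) (k : ℕ) : W :=
  cs.wordProd c ^ (k / c.length) * cs.wordProd (c.take (k % c.length))

theorem prefixElement_of_lt {k : ℕ} (hk : k < c.length) :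
    prefixElement cs c k = cs.wordProd (c.take k) := by
  rw [prefixElement, Nat.div_eq_of_lt hk, Nat.mod_eq_of_lt hk, pow_zero, one_mul]

theorem prefixElement_zero (c : List B) : prefixElement cs c 0 = 1 := by
  simp [prefixElement]

theorem prefixElement_length (hn : 0 < c.length) :
    prefixElement cs c c.length = cs.wordProd c := by
  simp [prefixElement, Nat.div_self hn]

theorem prefixElement_add_mul (hn : 0 < c.length) (k r : ℕ) :
    prefixElement cs c (k + r * c.length) = cs.wordProd c ^ r * prefixElement cs c k := by
  rw [prefixElement, prefixElement, Nat.add_mul_div_right _ _ hn, Nat.add_mul_mod_self_right,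
    add_comm (k / c.length), pow_add, mul_assoc]

theorem prefixElement_succ (hn : 0 < c.length) (k : ℕ) :
    prefixElement cs c (k + 1) = prefixElement cs c k * cs.simple (cyclicLetter c hn k) := by
  have hlt := Nat.mod_lt k hn
  have htake : cs.wordProd (c.take (k % c.length)) * cs.simple (cyclicLetter c hn k) =
      cs.wordProd (c.take (k % c.length + 1)) := by
    rw [List.take_succ_eq_append_getElem hlt, wordProd_append, wordProd_singleton, cyclicLetter]
  have hdiv : k + 1 = k % c.length + 1 + k / c.length * c.length := by
    rw [add_right_comm, Nat.mod_add_div']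
  have hprefix : prefixElement cs c k =
      cs.wordProd c ^ (k / c.length) * cs.wordProd (c.take (k % c.length)) := rfl
  rw [hdiv, prefixElement_add_mul cs hn, hprefix, mul_assoc, htake]
  rcases (Nat.add_one_le_of_lt hlt).lt_or_eq with h | h
  · rw [prefixElement_of_lt cs h]
  · rw [h, prefixElement_length cs hn, List.take_length]

end Letters

section CyclicRoots

variable {B W : Type*} [Group W] {M : CoxeterMatrix B} (cs : CoxeterSystem M W)
  [Fintype B] [DecidableEq B] {c : List B}

theorem geomRep_wordProd_apply_of_notMem {l : List B} {i : B} (hi : i ∉ l) (x : B → ℝ) :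
    geomRep cs (cs.wordProd l) x i = x i := by
  induction l with
  | nil => simp
  | cons j l ih =>
    rw [List.mem_cons, not_or] at hi
    rw [wordProd_cons, geomRep_mul, geomRep_simple, Pi.sub_apply, ih hi.2, Pi.smul_apply,
      simpleRoot, Pi.single_eq_of_ne hi.1, smul_zero, sub_zero]

theorem geomRep_wordProd_eq_self {l : List B} {x : B → ℝ}
    (h : ∀ i ∈ l, canonicalForm M (simpleRoot i) x = 0) : geomRep cs (cs.wordProd l) x = x := by
  induction l with
  | nil => simp
  | cons i l ih =>
    rw [List.forall_mem_cons] at h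
    rw [wordProd_cons, geomRep_mul, ih h.2, geomRep_simple, h.1, zero_smul, sub_zero]

/-- The root at position `k` of `c^∞`: the product of the first `k` letters applied to the simple
root of the next one. -/
noncomputable def cyclicRoot (hn : 0 < c.length) (k : ℕ) : B → ℝ :=
  geomRep cs (prefixElement cs c k) (simpleRoot (cyclicLetter c hn k))

theorem cyclicRoot_mem (hn : 0 < c.length) (k : ℕ) : cyclicRoot cs hn k ∈ rootSet cs :=
  geomRep_simpleRoot_mem cs _ _

theorem cyclicRoot_add_mul (hn : 0 < c.length) (k r : ℕ) :
    cyclicRoot cs hn (k + r * c.length) =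
      geomRep cs (cs.wordProd c ^ r) (cyclicRoot cs hn k) := by
  rw [cyclicRoot, cyclicRoot, cyclicLetter_add_mul, prefixElement_add_mul _ hn, geomRep_mul]

theorem cyclicRoot_add_length (hn : 0 < c.length) (k : ℕ) :
    cyclicRoot cs hn (k + c.length) = geomRep cs (cs.wordProd c) (cyclicRoot cs hn k) := by
  simpa only [one_mul, pow_one] using cyclicRoot_add_mul cs hn k 1

theorem cyclicRoot_eq_pow (hn : 0 < c.length) {k r : ℕ} (hr : r * c.length ≤ k) :
    cyclicRoot cs hn k =
      geomRep cs (cs.wordProd c ^ r) (cyclicRoot cs hn (k - r * c.length)) := by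
  rw [← cyclicRoot_add_mul, Nat.sub_add_cancel hr]

theorem cyclicRoot_apply_of_lt (hc : IsCoxeterWord c) (hn : 0 < c.length) {a b : ℕ}
    (hab : a ≤ b) (hb : b < c.length) :
    cyclicRoot cs hn a (cyclicLetter c hn b) = if a = b then 1 else 0 := by
  have ha := hab.trans_lt hb
  have hnotMem : getElem c b hb ∉ c.take a := by
    intro h
    obtain ⟨j, hj, hjb⟩ := List.mem_take_iff_getElem.1 h
    have := hc.1.getElem_inj_iff.1 hjb
    omega
  rw [cyclicRoot, prefixElement_of_lt _ ha, cyclicLetter_of_lt hn ha, cyclicLetter_of_lt hn hb,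
    geomRep_wordProd_apply_of_notMem cs hnotMem, simpleRoot, Pi.single_apply]
  simp only [hc.1.getElem_inj_iff, eq_comm]

theorem cyclicRoot_nonneg_of_lt (hc : IsCoxeterWord c) (hn : 0 < c.length) {a : ℕ}
    (ha : a < c.length) : 0 ≤ cyclicRoot cs hn a := by
  refine (nonneg_or_nonpos_of_mem_rootSet (cyclicRoot_mem cs hn a)).resolve_right fun h => ?_
  have hle := h (cyclicLetter c hn a)
  rw [cyclicRoot_apply_of_lt cs hc hn le_rfl ha, if_pos rfl] at hle
  exact absurd hle (by simp)

theorem exists_eq_cyclicRoot_of_nonpos (hn : 0 < c.length) {y : B → ℝ} (hy : y ∈ rootSet cs)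
    (hpos : 0 ≤ y) (hneg : geomRep cs (cs.wordProd c)⁻¹ y ≤ 0) :
    ∃ a < c.length, y = cyclicRoot cs hn a := by
  by_contra! hcon
  have hprefix : ∀ j ≤ c.length, 0 ≤ geomRep cs (prefixElement cs c j)⁻¹ y := by
    intro j hj
    induction j with
    | zero => rwa [prefixElement_zero, inv_one, geomRep_one]
    | succ j ih =>
      rw [prefixElement_succ _ hn, mul_inv_rev, inv_simple, geomRep_mul]
      refine geomRep_simple_nonneg (geomRep_mem _ hy) (ih (by omega)) fun h => hcon j (by omega) ?_
      rw [cyclicRoot, ← h, geomRep_apply_inv_self]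
  have hall := hprefix _ le_rfl
  rw [prefixElement_length _ hn] at hall
  exact not_nonpos_of_nonneg (geomRep_mem _ hy) hall hneg

/-- The positions of `c^∞` that belong to the `c`-sorting word of the longest element. They are
described by roots: the root at the position itself, and those at the same letter in all earlier
copies of `c`, are nonnegative. -/
def IsSortingPosition (hn : 0 < c.length) (k : ℕ) : Prop :=
  ∀ r, r * c.length ≤ k → 0 ≤ cyclicRoot cs hn (k - r * c.length)

variable {cs}

theorem IsSortingPosition.nonneg {hn : 0 < c.length} {k : ℕ} (h : IsSortingPosition cs hn k) :
    0 ≤ cyclicRoot cs hn k := by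
  simpa using h 0 (by simp)

theorem isSortingPosition_add_length_iff {hn : 0 < c.length} {k : ℕ} :
    IsSortingPosition cs hn (k + c.length) ↔
      0 ≤ cyclicRoot cs hn (k + c.length) ∧ IsSortingPosition cs hn k := by
  have hsub (r : ℕ) : k + c.length - (r + 1) * c.length = k - r * c.length := by
    rw [add_mul, one_mul, Nat.add_sub_add_right]
  refine ⟨fun h => ⟨h.nonneg, fun r hr => ?_⟩, fun h r hr => ?_⟩
  · rw [← hsub]
    exact h (r + 1) (by rw [add_mul]; omega)
  · cases r with
    | zero => simpa using h.1
    | succ r =>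
      rw [hsub]
      exact h.2 r (by rw [add_mul] at hr; omega)

theorem IsSortingPosition.sub_length {hn : 0 < c.length} {k : ℕ} (h : IsSortingPosition cs hn k)
    (hk : c.length ≤ k) : IsSortingPosition cs hn (k - c.length) :=
  (isSortingPosition_add_length_iff.1 ((Nat.sub_add_cancel hk).symm ▸ h)).2

theorem isSortingPosition_of_lt (hc : IsCoxeterWord c) (hn : 0 < c.length) {k : ℕ}
    (hk : k < c.length) : IsSortingPosition cs hn k :=
  fun _ _ => cyclicRoot_nonneg_of_lt cs hc hn (by omega)

theorem exists_cyclicRoot_eq_neg (hc : IsCoxeterWord c) {hn : 0 < c.length} {k : ℕ}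
    (hk : ¬IsSortingPosition cs hn k) :
    ∃ j, j / c.length ≤ k / c.length ∧ cyclicRoot cs hn k = -cyclicRoot cs hn j := by
  induction k using Nat.strong_induction_on with
  | _ k ih =>
    obtain ⟨k, rfl⟩ : ∃ k', k = k' + c.length := Nat.exists_eq_add_of_le'
      (not_lt.1 fun h => hk (isSortingPosition_of_lt hc hn h))
    rw [isSortingPosition_add_length_iff, not_and'] at hk
    by_cases hk' : IsSortingPosition cs hn k
    · have hneg : cyclicRoot cs hn (k + c.length) ≤ 0 :=
        (not_nonneg_iff_nonpos (cyclicRoot_mem cs hn _)).1 (hk hk')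
      obtain ⟨a, ha, hka⟩ := exists_eq_cyclicRoot_of_nonpos cs hn
        (neg_mem_rootSet (cyclicRoot_mem cs hn _)) (neg_nonneg.2 hneg) (by
          rw [cyclicRoot_add_length, map_neg, geomRep_inv_apply_self]
          exact neg_nonpos.2 hk'.nonneg)
      exact ⟨a, by rw [Nat.div_eq_of_lt ha]; exact Nat.zero_le _, by rw [← hka, neg_neg]⟩
    · obtain ⟨j, hj, hkj⟩ := ih k (by omega) hk'
      refine ⟨j + c.length, ?_, ?_⟩
      · rw [Nat.add_div_right _ hn, Nat.add_div_right _ hn]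
        exact Nat.succ_le_succ hj
      · rw [cyclicRoot_add_length, cyclicRoot_add_length, hkj, map_neg]

/-! ### The Euler form on the roots of `c^∞` -/

theorem eulerForm_cyclicRoot_of_length_le (hc : IsCoxeterWord c) {hn : 0 < c.length} {k : ℕ}
    (hk : c.length ≤ k) (y : B → ℝ) :
    eulerForm M c (cyclicRoot cs hn k) y =
      -eulerForm M c y (cyclicRoot cs hn (k - c.length)) := by
  rw [eulerForm_serre cs hc (cyclicRoot cs hn (k - c.length)), ← cyclicRoot_add_length,
    Nat.sub_add_cancel hk, neg_neg]

theorem le_and_div_le_sub_div {j k n : ℕ} (h : j / n < k / n) :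
    n ≤ k ∧ j / n ≤ (k - n) / n := by
  obtain ⟨hn, hnk⟩ := Nat.div_pos_iff.1 (Nat.zero_lt_of_lt h)
  exact ⟨hnk, Nat.lt_succ_iff.1 (h.trans_eq (Nat.div_eq_sub_div hn hnk))⟩

theorem cyclicRoot_eq_sub_of_lt (hc : IsCoxeterWord c) (hn : 0 < c.length) {a : ℕ}
    (ha : a < c.length) {x : B → ℝ}
    (hx : ∀ j, canonicalForm M (simpleRoot j) x = if j = cyclicLetter c hn a then 1 else 0) :
    cyclicRoot cs hn a = x - geomRep cs (cs.wordProd c) x := by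
  have hsplit : c.take a ++ cyclicLetter c hn a :: c.drop (a + 1) = c := by
    rw [cyclicLetter_of_lt hn ha, ← List.drop_eq_getElem_cons ha, List.take_append_drop]
  have hnotMem : cyclicLetter c hn a ∉ c.take a ∧ cyclicLetter c hn a ∉ c.drop (a + 1) := by
    have hnd := hc.1
    rw [← hsplit, List.nodup_middle, List.nodup_cons, List.mem_append, not_or] at hnd
    exact hnd.1
  have hfix (l : List B) (hl : cyclicLetter c hn a ∉ l) : geomRep cs (cs.wordProd l) x = x :=
    geomRep_wordProd_eq_self cs fun j hj => by rw [hx, if_neg (ne_of_mem_of_not_mem hj hl)]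
  rw [cyclicRoot, prefixElement_of_lt _ ha]
  nth_rw 3 [← hsplit]
  rw [wordProd_append, wordProd_cons, geomRep_mul, geomRep_mul, hfix _ hnotMem.2, geomRep_simple,
    hx, if_pos rfl, one_smul, map_sub, hfix _ hnotMem.1, sub_sub_cancel]

variable [Finite W]

theorem exists_fundamentalWeight (cs : CoxeterSystem M W) (i : B) :
    ∃ x : B → ℝ, ∀ j, canonicalForm M (simpleRoot j) x = if j = i then 1 else 0 := by
  let f : (B → ℝ) →ₗ[ℝ] (B → ℝ) := LinearMap.pi fun j => canonicalForm M (simpleRoot j)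
  have hinj : Function.Injective f := by
    rw [injective_iff_map_eq_zero]
    intro x hx
    by_contra hne
    have hflip : LinearMap.flip (canonicalForm M) x = 0 :=
      linearMap_ext_simpleRoot fun j => congrFun hx j
    exact (canonicalForm_pos cs hne).ne' (LinearMap.congr_fun hflip x)
  obtain ⟨x, hx⟩ := LinearMap.injective_iff_surjective.1 hinj (simpleRoot i)
  refine ⟨x, fun j => ?_⟩
  rw [← Pi.single_apply]
  exact congrFun hx j

theorem eulerForm_cyclicRoot_of_lt (hc : IsCoxeterWord c) (hn : 0 < c.length) {a : ℕ}
    (ha : a < c.length) (y : B → ℝ) :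
    eulerForm M c (cyclicRoot cs hn a) y = y (cyclicLetter c hn a) := by
  obtain ⟨x, hx⟩ := exists_fundamentalWeight cs (cyclicLetter c hn a)
  rw [cyclicRoot_eq_sub_of_lt hc hn ha hx, eulerForm_sub_wordProd cs hc]
  have hcoord : canonicalForm M x = LinearMap.proj (cyclicLetter c hn a) :=
    linearMap_ext_simpleRoot fun j => by
      rw [canonicalForm_comm, hx, LinearMap.proj_apply, simpleRoot, Pi.single_apply]
      simp only [eq_comm]
  exact LinearMap.congr_fun hcoord y

theorem IsSortingPosition.eulerForm_nonneg (hc : IsCoxeterWord c) {hn : 0 < c.length} {j k : ℕ}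
    (h : IsSortingPosition cs hn k) (hjk : j / c.length ≤ k / c.length) :
    0 ≤ eulerForm M c (cyclicRoot cs hn j) (cyclicRoot cs hn k) := by
  have hj : j / c.length * c.length ≤ j := Nat.div_mul_le_self _ _
  have hk : j / c.length * c.length ≤ k :=
    (Nat.mul_le_mul_right _ hjk).trans (Nat.div_mul_le_self _ _)
  rw [cyclicRoot_eq_pow cs hn hj, cyclicRoot_eq_pow cs hn hk, eulerForm_wordProd_pow cs hc,
    eulerForm_cyclicRoot_of_lt hc hn]
  · exact h _ hk _
  · rw [mul_comm, ← Nat.mod_eq_sub_mul_div]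
    exact Nat.mod_lt j hn

theorem eulerForm_cyclicRoot_of_div_eq (hc : IsCoxeterWord c) {hn : 0 < c.length} {j k : ℕ}
    (hjk : j < k) (hdiv : j / c.length = k / c.length) :
    eulerForm M c (cyclicRoot cs hn k) (cyclicRoot cs hn j) = 0 := by
  have hj : k / c.length * c.length ≤ j := hdiv ▸ Nat.div_mul_le_self _ _
  have hk : k / c.length * c.length ≤ k := Nat.div_mul_le_self _ _
  have hlt : k - k / c.length * c.length < c.length := by
    rw [mul_comm, ← Nat.mod_eq_sub_mul_div]
    exact Nat.mod_lt k hn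
  rw [cyclicRoot_eq_pow cs hn hj, cyclicRoot_eq_pow cs hn hk, eulerForm_wordProd_pow cs hc,
    eulerForm_cyclicRoot_of_lt hc hn hlt, cyclicRoot_apply_of_lt cs hc hn (by omega) hlt,
    if_neg (by omega)]

theorem IsSortingPosition.eulerForm_nonpos (hc : IsCoxeterWord c) {hn : 0 < c.length} {j k : ℕ}
    (h : IsSortingPosition cs hn k) (hjk : j < k) :
    eulerForm M c (cyclicRoot cs hn k) (cyclicRoot cs hn j) ≤ 0 := by
  rcases (Nat.div_le_div_right (c := c.length) hjk.le).eq_or_lt with hdiv | hdiv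
  · exact (eulerForm_cyclicRoot_of_div_eq hc hjk hdiv).le
  · obtain ⟨hk, hle⟩ := le_and_div_le_sub_div hdiv
    rw [eulerForm_cyclicRoot_of_length_le hc hk, neg_nonpos]
    exact (h.sub_length hk).eulerForm_nonneg hc hle

theorem IsSortingPosition.eulerForm_eq_zero (hc : IsCoxeterWord c) {hn : 0 < c.length} {j k : ℕ}
    (h : IsSortingPosition cs hn k) (hj : ¬IsSortingPosition cs hn j)
    (hjk : j / c.length ≤ k / c.length) :
    eulerForm M c (cyclicRoot cs hn j) (cyclicRoot cs hn k) = 0 := by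
  refine le_antisymm ?_ (h.eulerForm_nonneg hc hjk)
  obtain ⟨i, hij, hi⟩ := exists_cyclicRoot_eq_neg hc hj
  rw [hi, map_neg, LinearMap.neg_apply, neg_nonpos]
  exact h.eulerForm_nonneg hc (hij.trans hjk)

theorem IsSortingPosition.canonicalForm_eq_zero (hc : IsCoxeterWord c) {hn : 0 < c.length}
    {j k : ℕ} (h : IsSortingPosition cs hn k) (hj : ¬IsSortingPosition cs hn j) (hjk : j < k) :
    canonicalForm M (cyclicRoot cs hn j) (cyclicRoot cs hn k) = 0 := by
  have hdiv := Nat.div_le_div_right (c := c.length) hjk.le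
  rw [← eulerForm_add_flip hc, h.eulerForm_eq_zero hc hj hdiv, zero_add]
  rcases hdiv.eq_or_lt with hdiv | hdiv
  · exact eulerForm_cyclicRoot_of_div_eq hc hjk hdiv
  · obtain ⟨hk, hle⟩ := le_and_div_le_sub_div hdiv
    rw [eulerForm_cyclicRoot_of_length_le hc hk, (h.sub_length hk).eulerForm_eq_zero hc hj hle,
      neg_zero]

theorem injOn_cyclicRoot (hc : IsCoxeterWord c) (hn : 0 < c.length) :
    Set.InjOn (cyclicRoot cs hn) {k | IsSortingPosition cs hn k} := by
  have hne {j k : ℕ} (hk : IsSortingPosition cs hn k) (hjk : j < k) :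
      cyclicRoot cs hn j ≠ cyclicRoot cs hn k := by
    intro h
    have hle := hk.eulerForm_nonpos hc hjk
    rw [h] at hle
    exact hle.not_gt (eulerForm_pos cs hc (ne_zero_of_mem_rootSet (cyclicRoot_mem cs hn k)))
  intro j hj k hk h
  rcases lt_trichotomy j k with hjk | rfl | hjk
  · exact absurd h (hne hk hjk)
  · rfl
  · exact absurd h.symm (hne hj hjk)

theorem finite_setOf_isSortingPosition (hc : IsCoxeterWord c) (hn : 0 < c.length) :
    {k | IsSortingPosition cs hn k}.Finite :=
  Set.Finite.of_finite_image ((finite_rootSet cs).subset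
    (Set.image_subset_iff.2 fun k _ => cyclicRoot_mem cs hn k)) (injOn_cyclicRoot hc hn)

theorem eq_zero_of_geomRep_wordProd_eq_self (hc : IsCoxeterWord c) {y : B → ℝ}
    (h : geomRep cs (cs.wordProd c) y = y) : y = 0 := by
  by_contra hne
  have hform := eulerForm_sub_wordProd cs hc y y
  rw [h, sub_self, map_zero, LinearMap.zero_apply] at hform
  exact (canonicalForm_pos cs hne).ne hform

theorem exists_not_nonneg_pow (hc : IsCoxeterWord c) {x : B → ℝ} (hx : 0 ≤ x) (hx0 : x ≠ 0) :
    ∃ j, ¬0 ≤ geomRep cs ((cs.wordProd c)⁻¹ ^ j) x := by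
  by_contra! hcon
  set g := (cs.wordProd c)⁻¹
  set y := ∑ j ∈ Finset.range (orderOf g), geomRep cs (g ^ j) x with hy
  have hxy : x ≤ y := by
    have hmem : 0 ∈ Finset.range (orderOf g) := Finset.mem_range.2 (orderOf_pos g)
    simpa only [pow_zero, geomRep_one] using
      Finset.single_le_sum (f := fun j => geomRep cs (g ^ j) x) (fun j _ => hcon j) hmem
  have hfix : geomRep cs g y = y := by
    rw [← sub_eq_zero, hy, map_sum, ← Finset.sum_sub_distrib]
    simp only [← geomRep_mul, ← pow_succ']
    rw [Finset.sum_range_sub (fun j => geomRep cs (g ^ j) x), pow_orderOf_eq_one, pow_zero,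
      sub_self]
  have hy0 : y = 0 := eq_zero_of_geomRep_wordProd_eq_self hc <| by
    rw [← hfix, geomRep_apply_inv_self, hfix]
  exact hx0 (le_antisymm (hy0 ▸ hxy) hx)

theorem exists_nonneg_pow_and_nonpos_pow_succ (hc : IsCoxeterWord c) {x : B → ℝ}
    (hx : x ∈ rootSet cs) (hpos : 0 ≤ x) :
    ∃ m, (∀ j ≤ m, 0 ≤ geomRep cs ((cs.wordProd c)⁻¹ ^ j) x) ∧
      geomRep cs ((cs.wordProd c)⁻¹ ^ (m + 1)) x ≤ 0 := by
  classical
  have hex := exists_not_nonneg_pow (cs := cs) hc hpos (ne_zero_of_mem_rootSet hx)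
  obtain ⟨m, hm⟩ : ∃ m, Nat.find hex = m + 1 :=
    Nat.exists_eq_add_one_of_ne_zero ((Nat.find_pos hex).2 (by simpa using hpos)).ne'
  exact ⟨m, fun j hj => not_not.1 (Nat.find_min hex (by omega)),
    (not_nonneg_iff_nonpos (geomRep_mem _ hx)).1 (hm ▸ Nat.find_spec hex)⟩

theorem exists_isSortingPosition_eq (hc : IsCoxeterWord c) (hn : 0 < c.length) {x : B → ℝ}
    (hx : x ∈ rootSet cs) (hpos : 0 ≤ x) :
    ∃ k, IsSortingPosition cs hn k ∧ cyclicRoot cs hn k = x := by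
  obtain ⟨m, hmin, hneg⟩ := exists_nonneg_pow_and_nonpos_pow_succ hc hx hpos
  rw [pow_succ', geomRep_mul] at hneg
  obtain ⟨a, ha, hxa⟩ := exists_eq_cyclicRoot_of_nonpos cs hn
    (geomRep_mem ((cs.wordProd c)⁻¹ ^ m) hx) (hmin m le_rfl) hneg
  have hroot (r : ℕ) (hr : r ≤ m) :
      cyclicRoot cs hn (a + r * c.length) = geomRep cs ((cs.wordProd c)⁻¹ ^ (m - r)) x := by
    rw [cyclicRoot_add_mul, ← hxa, ← geomRep_mul]
    obtain ⟨s, rfl⟩ := Nat.exists_eq_add_of_le hr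
    rw [Nat.add_sub_cancel_left, pow_add, ← mul_assoc, inv_pow, mul_inv_cancel, one_mul]
  refine ⟨a + m * c.length, fun r hr => ?_, ?_⟩
  · have hrm : r ≤ m := by
      by_contra! hcon
      have := Nat.mul_le_mul_right c.length hcon
      rw [Nat.succ_mul] at this
      omega
    rw [Nat.add_sub_assoc (Nat.mul_le_mul_right _ hrm), ← Nat.sub_mul, hroot _ (Nat.sub_le _ _)]
    exact hmin _ (by omega)
  · rw [hroot m le_rfl, Nat.sub_self, pow_zero, geomRep_one]

end CyclicRoots

/-! ### The sorting word of the longest element -/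

section Words

variable {B W : Type*} [Group W] {M : CoxeterMatrix B} {cs : CoxeterSystem M W} {c : List B}

theorem isReduced_append_singleton {ω : List B} {i : B} (hω : cs.IsReduced ω)
    (h : ¬cs.IsRightDescent (cs.wordProd ω) i) : cs.IsReduced (ω ++ [i]) := by
  rw [CoxeterSystem.IsReduced, wordProd_append, wordProd_singleton, cs.not_isRightDescent_iff.1 h,
    hω, List.length_append, List.length_singleton]

theorem not_isRightDescent_of_isReduced_append_singleton {ω : List B} {i : B}
    (h : cs.IsReduced (ω ++ [i])) : ¬cs.IsRightDescent (cs.wordProd ω) i := by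
  intro hdesc
  have hle := cs.length_wordProd_le ω
  rw [CoxeterSystem.IsReduced, wordProd_append, wordProd_singleton, List.length_append,
    List.length_singleton] at h
  rw [IsRightDescent, h] at hdesc
  omega

variable (cs) in
theorem leftInvSeq_append_singleton (ω : List B) (i : B) :
    cs.leftInvSeq (ω ++ [i]) =
      cs.leftInvSeq ω ++ [cs.wordProd ω * cs.simple i * (cs.wordProd ω)⁻¹] := by
  rw [← List.concat_eq_append, leftInvSeq_concat, List.concat_eq_append]

theorem eq_map_of_isReducedSubword (hn : 0 < c.length) {w : W} {f : Fin (cs.length w) → ℕ}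
    {ω : List B} (h : cs.IsReducedSubword c w f ω) : ω = (List.ofFn f).map (cyclicLetter c hn) := by
  apply List.map_injective_iff.2 (Option.some_injective B)
  simp only [h.2.1, infiniteLetter_eq_some hn, List.map_ofFn, Function.comp_def]

theorem sortingWord_eq_of_forall_le (hc : IsCoxeterWord c) (hn : 0 < c.length) {w : W}
    {f : Fin (cs.length w) → ℕ} {ω : List B} (h : cs.IsReducedSubword c w f ω)
    (hmin : ∀ f' ω', cs.IsReducedSubword c w f' ω' → toLex f ≤ toLex f') :
    cs.sortingWord hc w = ω := by
  obtain ⟨f', h', hmin'⟩ := (cs.exists_isSortingWord hc w).choose_spec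
  obtain rfl : f' = f := toLex.injective ((hmin' f ω h).antisymm (hmin f' _ h'))
  exact (eq_map_of_isReducedSubword hn h').trans (eq_map_of_isReducedSubword hn h).symm

end Words

theorem exists_forall_lt_mem_range_iff_of_toLex_lt {k : ℕ} {f g : Fin k → ℕ} (hf : StrictMono f)
    (hg : StrictMono g) (h : toLex g < toLex f) :
    ∃ j, g j ∉ Set.range f ∧ ∀ x < g j, x ∈ Set.range f ↔ ∃ i < j, g i = x := by
  obtain ⟨j, hlt, hj⟩ := h
  simp only [Pi.toLex_apply] at hlt hj
  refine ⟨j, ?_, fun x hx => ⟨?_, ?_⟩⟩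
  · rintro ⟨i, hi⟩
    have hij : i < j := hf.lt_iff_lt.1 (hi.trans_lt hj)
    exact hij.ne (hg.injective ((hlt i hij).trans hi))
  · rintro ⟨i, rfl⟩
    have hij : i < j := hf.lt_iff_lt.1 (hx.trans hj)
    exact ⟨i, hij, hlt i hij⟩
  · rintro ⟨i, hij, rfl⟩
    exact ⟨i, (hlt i hij).symm⟩

section SortingWord

variable {B W : Type*} [Group W] {M : CoxeterMatrix B} (cs : CoxeterSystem M W)
  [Fintype B] [DecidableEq B] {c : List B}

open scoped Classical in
/-- The sorting positions before position `k`. -/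
noncomputable def sortingPositions (hn : 0 < c.length) (k : ℕ) : List ℕ :=
  (List.range k).filter fun j => IsSortingPosition cs hn j

/-- The letters of `c^∞` at the sorting positions before position `k`. -/
noncomputable def sortedPrefix (hn : 0 < c.length) (k : ℕ) : List B :=
  (sortingPositions cs hn k).map (cyclicLetter c hn)

/-- The reflection at position `k` of `c^∞`. -/
def cyclicReflection (hn : 0 < c.length) (k : ℕ) : W :=
  prefixElement cs c k * cs.simple (cyclicLetter c hn k) * (prefixElement cs c k)⁻¹

theorem isReflectionAlong_cyclicReflection (hn : 0 < c.length) (k : ℕ) :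
    IsReflectionAlong cs (cyclicReflection cs hn k) (cyclicRoot cs hn k) :=
  isReflectionAlong_geomRep cs _ _

theorem sortedLT_sortingPositions (hn : 0 < c.length) (k : ℕ) :
    (sortingPositions cs hn k).SortedLT :=
  (List.pairwise_lt_range.filter _).sortedLT

variable {cs}

theorem mem_sortingPositions {hn : 0 < c.length} {j k : ℕ} :
    j ∈ sortingPositions cs hn k ↔ j < k ∧ IsSortingPosition cs hn j := by
  simp [sortingPositions]

theorem sortingPositions_eq_iff {hn : 0 < c.length} {k : ℕ} {l : List ℕ} (hl : l.SortedLT) :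
    sortingPositions cs hn k = l ↔ ∀ j, j < k ∧ IsSortingPosition cs hn j ↔ j ∈ l := by
  simp only [← mem_sortingPositions]
  exact ⟨fun h j => by rw [h], (sortedLT_sortingPositions cs hn k).eq_of_mem_iff hl⟩

theorem sortingPositions_succ_of_pos {hn : 0 < c.length} {k : ℕ} (h : IsSortingPosition cs hn k) :
    sortingPositions cs hn (k + 1) = sortingPositions cs hn k ++ [k] := by
  simp [sortingPositions, List.range_succ, h]

theorem sortingPositions_succ_of_neg {hn : 0 < c.length} {k : ℕ}
    (h : ¬IsSortingPosition cs hn k) :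
    sortingPositions cs hn (k + 1) = sortingPositions cs hn k := by
  simp [sortingPositions, List.range_succ, h]

theorem sortedPrefix_succ_of_pos {hn : 0 < c.length} {k : ℕ} (h : IsSortingPosition cs hn k) :
    sortedPrefix cs hn (k + 1) = sortedPrefix cs hn k ++ [cyclicLetter c hn k] := by
  simp only [sortedPrefix, sortingPositions_succ_of_pos h, List.map_append, List.map_singleton]

theorem sortedPrefix_succ_of_neg {hn : 0 < c.length} {k : ℕ} (h : ¬IsSortingPosition cs hn k) :
    sortedPrefix cs hn (k + 1) = sortedPrefix cs hn k := by
  rw [sortedPrefix, sortingPositions_succ_of_neg h, sortedPrefix]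

/-- The letters that `sortedPrefix` skips act trivially on vectors orthogonal to their roots. -/
theorem geomRep_sortedPrefix_inv {hn : 0 < c.length} {k : ℕ} {y : B → ℝ}
    (h : ∀ j < k, ¬IsSortingPosition cs hn j → canonicalForm M (cyclicRoot cs hn j) y = 0) :
    geomRep cs (cs.wordProd (sortedPrefix cs hn k))⁻¹ y =
      geomRep cs (prefixElement cs c k)⁻¹ y := by
  induction k with
  | zero => simp [sortedPrefix, sortingPositions, prefixElement_zero]
  | succ k ih =>
    have ih := ih fun j hj => h j (by omega)
    rw [prefixElement_succ _ hn, mul_inv_rev, inv_simple, geomRep_mul, ← ih]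
    by_cases hk : IsSortingPosition cs hn k
    · rw [sortedPrefix_succ_of_pos hk, wordProd_append, wordProd_singleton, mul_inv_rev, inv_simple,
        geomRep_mul]
    · have horth := h k (by omega) hk
      rw [cyclicRoot, canonicalForm_geomRep_left, ← ih] at horth
      rw [sortedPrefix_succ_of_neg hk, geomRep_simple, horth, zero_smul, sub_zero]

variable [Finite W]

theorem IsSortingPosition.geomRep_sortedPrefix (hc : IsCoxeterWord c) {hn : 0 < c.length} {k : ℕ}
    (h : IsSortingPosition cs hn k) :
    geomRep cs (cs.wordProd (sortedPrefix cs hn k)) (simpleRoot (cyclicLetter c hn k)) =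
      cyclicRoot cs hn k := by
  have hinv := geomRep_sortedPrefix_inv (k := k) fun j hj hj' => h.canonicalForm_eq_zero hc hj' hj
  rw [← geomRep_inv_apply_self cs (prefixElement cs c k) (simpleRoot (cyclicLetter c hn k)),
    ← cyclicRoot, ← hinv, geomRep_apply_inv_self]

theorem isReduced_sortedPrefix (hc : IsCoxeterWord c) (hn : 0 < c.length) (k : ℕ) :
    cs.IsReduced (sortedPrefix cs hn k) := by
  induction k with
  | zero => simp [sortedPrefix, sortingPositions, CoxeterSystem.IsReduced]
  | succ k ih =>
    by_cases hk : IsSortingPosition cs hn k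
    · rw [sortedPrefix_succ_of_pos hk]
      refine isReduced_append_singleton ih ?_
      rw [not_isRightDescent_iff_nonneg, hk.geomRep_sortedPrefix hc]
      exact hk.nonneg
    · rwa [sortedPrefix_succ_of_neg hk]

theorem leftInvSeq_sortedPrefix (hc : IsCoxeterWord c) (hn : 0 < c.length) (k : ℕ) :
    cs.leftInvSeq (sortedPrefix cs hn k) =
      (sortingPositions cs hn k).map (cyclicReflection cs hn) := by
  induction k with
  | zero => simp [sortedPrefix, sortingPositions]
  | succ k ih =>
    by_cases hk : IsSortingPosition cs hn k
    · have hrefl := isReflectionAlong_geomRep cs (cs.wordProd (sortedPrefix cs hn k))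
        (cyclicLetter c hn k)
      rw [hk.geomRep_sortedPrefix hc] at hrefl
      rw [sortedPrefix_succ_of_pos hk, leftInvSeq_append_singleton, sortingPositions_succ_of_pos hk,
        List.map_append, ih, List.map_singleton,
        hrefl.unique (isReflectionAlong_cyclicReflection cs hn k)]
    · rw [sortedPrefix_succ_of_neg hk, sortingPositions_succ_of_neg hk, ih]

theorem isRightDescent_sortedPrefix (hc : IsCoxeterWord c) {hn : 0 < c.length} {k : ℕ}
    (hk : ¬IsSortingPosition cs hn k) :
    cs.IsRightDescent (cs.wordProd (sortedPrefix cs hn k)) (cyclicLetter c hn k) := by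
  by_contra hcon
  have hrefl := isReflectionAlong_geomRep cs (cs.wordProd (sortedPrefix cs hn k))
    (cyclicLetter c hn k)
  obtain ⟨l, hl, hly⟩ := exists_isSortingPosition_eq hc hn
    (geomRep_simpleRoot_mem cs (cs.wordProd (sortedPrefix cs hn k)) (cyclicLetter c hn k))
    (not_isRightDescent_iff_nonneg.1 hcon)
  rw [← hly] at hrefl
  rcases lt_trichotomy l k with hlk | rfl | hkl
  · have hnodup :=
      (isReduced_append_singleton (isReduced_sortedPrefix hc hn k) hcon).nodup_leftInvSeq
    rw [leftInvSeq_append_singleton, leftInvSeq_sortedPrefix hc, List.nodup_append] at hnodup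
    exact hnodup.2.2 _ (List.mem_map_of_mem (mem_sortingPositions.2 ⟨hlk, hl⟩)) _
      (List.mem_singleton_self _) ((isReflectionAlong_cyclicReflection cs hn l).unique hrefl)
  · exact hk hl
  · have hinv := geomRep_sortedPrefix_inv (k := k) fun j hj hj' =>
      hl.canonicalForm_eq_zero hc hj' (hj.trans hkl)
    conv_lhs at hinv => rw [hly, geomRep_inv_apply_self]
    have horth := hl.canonicalForm_eq_zero hc hk hkl
    rw [cyclicRoot, hinv, geomRep_apply_inv_self] at horth
    exact (canonicalForm_pos cs (ne_zero_of_mem_rootSet (cyclicRoot_mem cs hn l))).ne' horth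

theorem wordProd_sortedPrefix (hc : IsCoxeterWord c) {hn : 0 < c.length} {k : ℕ}
    (hk : ∀ j, IsSortingPosition cs hn j → j < k) :
    cs.wordProd (sortedPrefix cs hn k) = cs.longest := by
  refine eq_longest_of_forall_isRightDescent cs fun i => ?_
  obtain ⟨a, -, rfl⟩ := exists_cyclicLetter_eq hc hn i
  have hle : k ≤ a + k * c.length := (Nat.le_mul_of_pos_right k hn).trans (Nat.le_add_left _ _)
  have heq : sortingPositions cs hn (a + k * c.length) = sortingPositions cs hn k := by
    refine (sortingPositions_eq_iff (sortedLT_sortingPositions cs hn k)).2 fun j => ?_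
    rw [mem_sortingPositions]
    exact ⟨fun h => ⟨hk j h.2, h.2⟩, fun h => ⟨h.1.trans_le hle, h.2⟩⟩
  have hdesc := isRightDescent_sortedPrefix hc fun h => absurd (hk (a + k * c.length) h) (by omega)
  rwa [cyclicLetter_add_mul, sortedPrefix, heq] at hdesc

variable (cs) in
/-- The position in `c^∞` of the letter with index `i` of the `c`-sorting word of the longest
element. It is meaningful only if `i` is less than the length of the longest element. -/
noncomputable def sortingPosition (hn : 0 < c.length) (i : ℕ) : ℕ :=
  Nat.nth (IsSortingPosition cs hn) i

theorem exists_sortingPositions_eq (hc : IsCoxeterWord c) (hn : 0 < c.length) :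
    ∃ k, (∀ j, IsSortingPosition cs hn j → j < k) ∧ sortingPositions cs hn k =
      (List.range (finite_setOf_isSortingPosition (cs := cs) hc hn).toFinset.card).map
        (sortingPosition cs hn) := by
  have hfin := finite_setOf_isSortingPosition (cs := cs) hc hn
  obtain ⟨k, hk⟩ := hfin.bddAbove
  have hlt {j : ℕ} (hj : IsSortingPosition cs hn j) : j < k + 1 := Nat.lt_succ_of_le (hk hj)
  refine ⟨k + 1, fun j => hlt, (sortingPositions_eq_iff (List.Pairwise.sortedLT ?_)).2 fun j => ?_⟩
  · rw [List.pairwise_map]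
    exact List.pairwise_lt_range.imp_of_mem fun _ hj hij =>
      Nat.nth_lt_nth_of_lt_card hfin hij (List.mem_range.1 hj)
  · simp only [List.mem_map, List.mem_range]
    refine ⟨fun h => Nat.exists_lt_card_finite_nth_eq hfin h.2, ?_⟩
    rintro ⟨i, hi, rfl⟩
    have hpos := Nat.nth_mem_of_lt_card hfin hi
    exact ⟨hlt hpos, hpos⟩

theorem length_longest (hc : IsCoxeterWord c) (hn : 0 < c.length) :
    cs.length cs.longest = (finite_setOf_isSortingPosition (cs := cs) hc hn).toFinset.card := by
  obtain ⟨k, hk, heq⟩ := exists_sortingPositions_eq (cs := cs) hc hn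
  rw [← wordProd_sortedPrefix hc hk, isReduced_sortedPrefix hc, sortedPrefix, List.length_map, heq,
    List.length_map, List.length_range]

theorem isSortingPosition_sortingPosition (hc : IsCoxeterWord c) {hn : 0 < c.length} {i : ℕ}
    (hi : i < cs.length cs.longest) : IsSortingPosition cs hn (sortingPosition cs hn i) :=
  Nat.nth_mem_of_lt_card _ (hi.trans_eq (length_longest hc hn))

theorem sortingPosition_lt (hc : IsCoxeterWord c) {hn : 0 < c.length} {i j : ℕ} (hij : i < j)
    (hj : j < cs.length cs.longest) : sortingPosition cs hn i < sortingPosition cs hn j :=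
  Nat.nth_lt_nth_of_lt_card _ hij (hj.trans_eq (length_longest hc hn))

theorem IsSortingPosition.exists_sortingPosition_eq (hc : IsCoxeterWord c) {hn : 0 < c.length}
    {k : ℕ} (h : IsSortingPosition cs hn k) :
    ∃ i < cs.length cs.longest, sortingPosition cs hn i = k := by
  rw [length_longest hc hn]
  exact Nat.exists_lt_card_finite_nth_eq _ h

theorem exists_sortedPrefix_eq_longest (hc : IsCoxeterWord c) (hn : 0 < c.length) :
    ∃ k, cs.wordProd (sortedPrefix cs hn k) = cs.longest ∧ sortingPositions cs hn k =
      (List.range (cs.length cs.longest)).map (sortingPosition cs hn) := by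
  obtain ⟨k, hk, heq⟩ := exists_sortingPositions_eq (cs := cs) hc hn
  exact ⟨k, wordProd_sortedPrefix hc hk, by rw [heq, length_longest hc hn]⟩

theorem range_sortingPosition (hc : IsCoxeterWord c) (hn : 0 < c.length) :
    Set.range (fun i : Fin (cs.length cs.longest) => sortingPosition cs hn i) =
      {k | IsSortingPosition cs hn k} := by
  ext k
  refine ⟨?_, fun hk => ?_⟩
  · rintro ⟨i, rfl⟩
    exact isSortingPosition_sortingPosition hc i.2
  · obtain ⟨i, hi, rfl⟩ := hk.exists_sortingPosition_eq hc
    exact ⟨⟨i, hi⟩, rfl⟩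

/-- Where `f` first deviates downwards it picks a position that is not sorting, whose letter is a
right descent of the prefix chosen so far. -/
theorem toLex_sortingPosition_le (hc : IsCoxeterWord c) (hn : 0 < c.length)
    {f : Fin (cs.length cs.longest) → ℕ} {ω : List B}
    (h : cs.IsReducedSubword c cs.longest f ω) :
    toLex (fun i : Fin (cs.length cs.longest) => sortingPosition cs hn i) ≤ toLex f := by
  by_contra! hlt
  obtain ⟨j, hj, hbefore⟩ := exists_forall_lt_mem_range_iff_of_toLex_lt
    (fun i i' hii' => sortingPosition_lt hc hii' i'.2) h.1 hlt
  simp only [range_sortingPosition hc, Set.mem_ofPred_eq] at hj hbefore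
  have htake : sortingPositions cs hn (f j) = (List.ofFn f).take j := by
    refine (sortingPositions_eq_iff ((List.sortedLT_ofFn_iff.2 h.1).pairwise.sublist
      (List.take_sublist _ _)).sortedLT).2 fun x => ?_
    rw [List.mem_take_iff_getElem]
    simp only [List.getElem_ofFn, List.length_ofFn]
    constructor
    · rintro ⟨hx, hs⟩
      obtain ⟨i, hij, hix⟩ := (hbefore x hx).1 hs
      exact ⟨i, lt_min hij i.2, hix⟩
    · rintro ⟨i, hi, rfl⟩
      have hij : (⟨i, hi.trans_le (min_le_right _ _)⟩ : Fin _) < j := hi.trans_le (min_le_left _ _)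
      exact ⟨h.1 hij, (hbefore _ (h.1 hij)).2 ⟨_, hij, rfl⟩⟩
  have hred := h.2.2.1.take (j + 1)
  rw [eq_map_of_isReducedSubword hn h, ← List.map_take, List.take_succ_eq_append_getElem (by simp),
    List.map_append, ← htake, List.getElem_ofFn] at hred
  exact not_isRightDescent_of_isReduced_append_singleton hred (isRightDescent_sortedPrefix hc hj)

theorem sortingWord_longest (hc : IsCoxeterWord c) (hn : 0 < c.length) :
    cs.sortingWord hc cs.longest = (List.range (cs.length cs.longest)).map fun i =>
      cyclicLetter c hn (sortingPosition cs hn i) := by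
  obtain ⟨k, hprod, heq⟩ := exists_sortedPrefix_eq_longest (cs := cs) hc hn
  have hword : sortedPrefix cs hn k = (List.range (cs.length cs.longest)).map fun i =>
      cyclicLetter c hn (sortingPosition cs hn i) := by
    rw [sortedPrefix, heq, List.map_map, Function.comp_def]
  refine sortingWord_eq_of_forall_le hc hn ⟨fun i j hij => sortingPosition_lt hc hij j.2, ?_,
    hword ▸ isReduced_sortedPrefix hc hn k, hword ▸ hprod⟩
    fun f ω h => toLex_sortingPosition_le hc hn h
  simp only [infiniteLetter_eq_some hn, List.map_map, Function.comp_def, List.ofFn_eq_map,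
    ← List.map_coe_finRange_eq_range]

theorem leftInvSeq_sortingWord_longest (hc : IsCoxeterWord c) (hn : 0 < c.length) :
    cs.leftInvSeq (cs.sortingWord hc cs.longest) = (List.range (cs.length cs.longest)).map fun i =>
      cyclicReflection cs hn (sortingPosition cs hn i) := by
  obtain ⟨k, -, heq⟩ := exists_sortedPrefix_eq_longest (cs := cs) hc hn
  have hword : cs.sortingWord hc cs.longest = sortedPrefix cs hn k := by
    rw [sortingWord_longest hc hn, sortedPrefix, heq, List.map_map, Function.comp_def]
  rw [hword, leftInvSeq_sortedPrefix hc, heq, List.map_map, Function.comp_def]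

end SortingWord

/-! ### The sorted root sequence of a Coxeter element -/

section SignedRoots

variable {B W : Type*} [Group W] {M : CoxeterMatrix B} (cs : CoxeterSystem M W)
  [Fintype B] [DecidableEq B] {c : List B}

/-- The negated images of the first `c.length` roots of `c^∞` under the inverse of the Coxeter
element. They are the roots attached to the leading `c` of the word `c w_∘^m(c)`. -/
noncomputable def initialRoot (hn : 0 < c.length) (a : ℕ) : B → ℝ :=
  -geomRep cs (cs.wordProd c)⁻¹ (cyclicRoot cs hn a)

variable [Finite W]

/-- The roots of the `c`-sorting word of the longest element, continued antiperiodically. They are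
the roots attached to the letters of `w_∘^m(c)`. -/
noncomputable def signedRoot (hn : 0 < c.length) (i : ℕ) : B → ℝ :=
  (-1 : ℝ) ^ (i / cs.length cs.longest) •
    cyclicRoot cs hn (sortingPosition cs hn (i % cs.length cs.longest))

variable {cs}

theorem signedRoot_of_lt {hn : 0 < c.length} {i : ℕ} (hi : i < cs.length cs.longest) :
    signedRoot cs hn i = cyclicRoot cs hn (sortingPosition cs hn i) := by
  rw [signedRoot, Nat.div_eq_of_lt hi, Nat.mod_eq_of_lt hi, pow_zero, one_smul]

theorem signedRoot_nonneg_of_lt (hc : IsCoxeterWord c) {hn : 0 < c.length} {i : ℕ}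
    (hi : i < cs.length cs.longest) : 0 ≤ signedRoot cs hn i := by
  rw [signedRoot_of_lt hi]
  exact (isSortingPosition_sortingPosition hc hi).nonneg

theorem signedRoot_mem (hn : 0 < c.length) (i : ℕ) : signedRoot cs hn i ∈ rootSet cs := by
  rw [signedRoot]
  rcases neg_one_pow_eq_or ℝ (i / cs.length cs.longest) with h | h
  · rw [h, one_smul]
    exact cyclicRoot_mem cs hn _
  · rw [h, neg_one_smul]
    exact neg_mem_rootSet (cyclicRoot_mem cs hn _)

theorem signedRoot_add_length (hc : IsCoxeterWord c) (hn : 0 < c.length) (i : ℕ) :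
    signedRoot cs hn (i + cs.length cs.longest) = -signedRoot cs hn i := by
  obtain ⟨j, hj, -⟩ := (isSortingPosition_of_lt (cs := cs) hc hn hn).exists_sortingPosition_eq hc
  rw [signedRoot, signedRoot, Nat.add_div_right _ (Nat.zero_lt_of_lt hj), Nat.add_mod_right,
    pow_succ, mul_neg_one, neg_smul]

theorem exists_eq_signedRoot (hc : IsCoxeterWord c) (hn : 0 < c.length) {x : B → ℝ}
    (hx : x ∈ rootSet cs) (hpos : 0 ≤ x) :
    ∃ i < cs.length cs.longest, x = signedRoot cs hn i := by
  obtain ⟨k, hk, rfl⟩ := exists_isSortingPosition_eq hc hn hx hpos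
  obtain ⟨i, hi, rfl⟩ := hk.exists_sortingPosition_eq hc
  exact ⟨i, hi, (signedRoot_of_lt hi).symm⟩

theorem exists_eq_signedRoot_or_neg (hc : IsCoxeterWord c) (hn : 0 < c.length) {x : B → ℝ}
    (hx : x ∈ rootSet cs) :
    ∃ i < cs.length cs.longest, x = signedRoot cs hn i ∨ x = -signedRoot cs hn i := by
  rcases nonneg_or_nonpos_of_mem_rootSet hx with h | h
  · obtain ⟨i, hi, hxi⟩ := exists_eq_signedRoot hc hn hx h
    exact ⟨i, hi, Or.inl hxi⟩
  · obtain ⟨i, hi, hxi⟩ := exists_eq_signedRoot hc hn (neg_mem_rootSet hx) (neg_nonneg.2 h)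
    exact ⟨i, hi, Or.inr (by rw [← hxi, neg_neg])⟩

theorem eulerForm_signedRoot_nonneg (hc : IsCoxeterWord c) {hn : 0 < c.length} {i j : ℕ}
    (hij : i ≤ j) (hji : j < i + cs.length cs.longest) :
    0 ≤ eulerForm M c (signedRoot cs hn i) (signedRoot cs hn j) := by
  induction i using Nat.strong_induction_on generalizing j with
  | _ i ih =>
    rcases lt_or_ge i (cs.length cs.longest) with hi | hi
    · rcases lt_or_ge j (cs.length cs.longest) with hj | hj
      · rw [signedRoot_of_lt hi, signedRoot_of_lt hj]
        refine (isSortingPosition_sortingPosition hc hj).eulerForm_nonneg hc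
          (Nat.div_le_div_right ?_)
        rcases hij.eq_or_lt with rfl | hlt
        · exact le_rfl
        · exact (sortingPosition_lt hc hlt hj).le
      · obtain ⟨j, rfl⟩ := Nat.exists_eq_add_of_le' hj
        have hji : j < i := Nat.lt_of_add_lt_add_right hji
        rw [signedRoot_add_length hc, signedRoot_of_lt hi, signedRoot_of_lt (hji.trans hi), map_neg,
          neg_nonneg]
        exact (isSortingPosition_sortingPosition hc hi).eulerForm_nonpos hc
          (sortingPosition_lt hc hji hi)
    · obtain ⟨i, rfl⟩ := Nat.exists_eq_add_of_le' hi
      obtain ⟨j, rfl⟩ := Nat.exists_eq_add_of_le' (hi.trans hij)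
      rw [signedRoot_add_length hc, signedRoot_add_length hc, map_neg, map_neg,
        LinearMap.neg_apply, neg_neg]
      exact ih i (by omega) (by omega) (by omega)

theorem eulerForm_initialRoot (hc : IsCoxeterWord c) (hn : 0 < c.length) {b : ℕ}
    (hb : b < c.length) (y : B → ℝ) :
    eulerForm M c y (initialRoot cs hn b) = y (cyclicLetter c hn b) := by
  rw [initialRoot, map_neg, eulerForm_serre cs hc, geomRep_apply_inv_self, neg_neg,
    eulerForm_cyclicRoot_of_lt hc hn hb]

theorem eulerForm_initialRoot_of_lt (hc : IsCoxeterWord c) (hn : 0 < c.length) {a b : ℕ}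
    (hba : b < a) (ha : a < c.length) :
    eulerForm M c (initialRoot cs hn a) (initialRoot cs hn b) = 0 := by
  have himage (d : ℕ) :
      geomRep cs (cs.wordProd c) (initialRoot cs hn d) = -cyclicRoot cs hn d := by
    rw [initialRoot, map_neg, geomRep_apply_inv_self]
  rw [← eulerForm_wordProd_pow cs hc 1, pow_one, himage, himage, map_neg, map_neg,
    LinearMap.neg_apply, neg_neg, eulerForm_cyclicRoot_of_lt hc hn ha,
    cyclicRoot_apply_of_lt cs hc hn hba.le ha, if_neg hba.ne]

theorem eq_zero_of_forall_eulerForm_initialRoot (hc : IsCoxeterWord c) (hn : 0 < c.length)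
    {x : B → ℝ} (hx : ∀ b < c.length, eulerForm M c x (initialRoot cs hn b) = 0) : x = 0 := by
  funext i
  obtain ⟨a, ha, rfl⟩ := exists_cyclicLetter_eq hc hn i
  rw [← eulerForm_initialRoot (cs := cs) hc hn ha x, hx a ha, Pi.zero_apply]

theorem exists_signedRoot_eq_initialRoot (hc : IsCoxeterWord c) {hn : 0 < c.length} {i j : ℕ}
    (hi : i < cs.length cs.longest) (hj : j < cs.length cs.longest)
    (h : geomRep cs (cs.wordProd c) (signedRoot cs hn i) = -signedRoot cs hn j) :
    ∃ a < c.length, signedRoot cs hn i = initialRoot cs hn a := by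
  have hinv : geomRep cs (cs.wordProd c)⁻¹ (signedRoot cs hn j) = -signedRoot cs hn i := by
    rw [← neg_neg (signedRoot cs hn j), ← h, map_neg, geomRep_inv_apply_self]
  obtain ⟨a, ha, hja⟩ := exists_eq_cyclicRoot_of_nonpos cs hn (signedRoot_mem hn j)
    (signedRoot_nonneg_of_lt hc hj) (hinv ▸ neg_nonpos.2 (signedRoot_nonneg_of_lt hc hi))
  exact ⟨a, ha, by rw [initialRoot, ← hja, hinv, neg_neg]⟩

theorem isSortedRootSequence (hc : IsCoxeterWord c) (hn : 0 < c.length) :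
    IsSortedRootSequence (eulerForm M c) (rootSet cs) (geomRep cs (cs.wordProd c)).toLinearMap
      c.length (cs.length cs.longest) (initialRoot cs hn) (signedRoot cs hn) where
  pos _ hx := eulerForm_pos cs hc hx
  ne_zero _ hx := ne_zero_of_mem_rootSet hx
  γ_mem := signedRoot_mem hn
  ρ_mem a _ := neg_mem_rootSet (geomRep_mem _ (cyclicRoot_mem cs hn a))
  reflect_mem x hx g hg := by
    obtain ⟨w, i, rfl⟩ := hg
    rw [(isReflectionAlong_geomRep cs w i).reflectAlong_eq hc]
    exact geomRep_mem _ hx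
  c_mem _ hx := geomRep_mem _ hx
  serre := eulerForm_serre cs hc
  antiperiodic := signedRoot_add_length hc hn
  nonneg _ _ := eulerForm_signedRoot_nonneg hc
  cover _ := exists_eq_signedRoot_or_neg hc hn
  coef_nonneg i hi b hb := by
    rw [eulerForm_initialRoot hc hn hb]
    exact signedRoot_nonneg_of_lt hc hi _
  ρ_triangular _ ha _ hba := eulerForm_initialRoot_of_lt hc hn hba ha
  eq_zero _ := eq_zero_of_forall_eulerForm_initialRoot hc hn
  initial _ hi _ hj := exists_signedRoot_eq_initialRoot hc hi hj

end SignedRoots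

/-! ### Complements of subwords -/

section ComplementWord

theorem filter_finRange_eq_sort {k : ℕ} (F : Finset (Fin k)) :
    (List.finRange k).filter (· ∈ F) = F.sort := by
  refine ((List.sortedLT_finRange k).pairwise.filter _).sortedLT.eq_of_mem_iff
    F.sortedLT_sort fun i => ?_
  rw [List.mem_filter, Finset.mem_sort, decide_eq_true_iff, and_iff_right (List.mem_finRange i)]

variable {B : Type*}

theorem length_complementWord_add_card (Q : List B) (F : Finset (Fin Q.length)) :
    (complementWord Q F).length + F.card = Q.length := by
  have hsplit := List.length_eq_length_filter_add (l := List.finRange Q.length) (· ∈ F)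
  simp only [filter_finRange_eq_sort, Finset.length_sort, List.length_finRange, ← decide_not]
    at hsplit
  rw [complementWord, List.length_map, add_comm]
  exact hsplit.symm

theorem length_complementWord_eq_iff {c Q : List B} (F : Finset (Fin (c ++ Q).length)) :
    (complementWord (c ++ Q) F).length = Q.length ↔ F.card = c.length := by
  have hlen := length_complementWord_add_card (c ++ Q) F
  have happend : (c ++ Q).length = c.length + Q.length := List.length_append
  omega

theorem complementWord_append (Q Q' : List B) :
    complementWord (Q ++ Q') (Finset.univ.filter fun i => (i : ℕ) < Q.length) = Q' := by
  rw [complementWord, ← List.take_append_drop Q.length (List.finRange _), List.filter_append,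
    List.filter_eq_nil_iff.2, List.filter_eq_self.2, List.nil_append, List.map_drop,
    List.map_get_finRange, List.drop_left]
  · intro i hi
    obtain ⟨a, ha, rfl⟩ := List.mem_drop_iff_getElem.1 hi
    simp
  · intro i hi
    obtain ⟨a, ha, rfl⟩ := List.mem_take_iff_getElem.1 hi
    simpa using (lt_min_iff.1 ha).1

variable {W : Type*} [Group W] {M : CoxeterMatrix B} (cs : CoxeterSystem M W)

/-- Each omitted letter `q_k` contributes the reflection `(q_1 ⋯ q_{k-1}) q_k (q_1 ⋯ q_{k-1})⁻¹`
on the left. -/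
theorem wordProd_filter_take_finRange (Q : List B) (F : Finset (Fin Q.length)) {k : ℕ}
    (hk : k ≤ Q.length) :
    cs.wordProd ((((List.finRange Q.length).take k).filter (· ∉ F)).map Q.get) =
      ((((List.finRange Q.length).take k).filter (· ∈ F)).map fun i : Fin Q.length =>
        (cs.leftInvSeq Q).getD i 1).prod * cs.wordProd (Q.take k) := by
  induction k with
  | zero => simp
  | succ k ih =>
    have hinv := cs.getElem_leftInvSeq Q k hk
    rw [List.take_succ_eq_append_getElem (by simpa using hk), List.filter_append,
      List.filter_append, List.map_append, List.map_append, wordProd_append,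
      ih (Nat.le_of_succ_le hk), List.prod_append, List.take_succ_eq_append_getElem hk,
      wordProd_append, wordProd_singleton, List.getElem_finRange]
    by_cases hF : (⟨k, hk⟩ : Fin Q.length) ∈ F
    · simp [hF, hinv, mul_assoc]
    · simp [hF, mul_assoc]

theorem wordProd_complementWord (Q : List B) (F : Finset (Fin Q.length)) :
    cs.wordProd (complementWord Q F) =
      (F.sort.map fun i : Fin Q.length => (cs.leftInvSeq Q).getD i 1).prod * cs.wordProd Q := by
  have htake := wordProd_filter_take_finRange cs Q F le_rfl
  rwa [List.take_of_length_le (List.length_finRange).le, List.take_length,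
    filter_finRange_eq_sort] at htake

theorem leftInvSeq_append (ω ω' : List B) :
    cs.leftInvSeq (ω ++ ω') =
      cs.leftInvSeq ω ++ (cs.leftInvSeq ω').map (MulAut.conj (cs.wordProd ω)) := by
  induction ω with
  | nil => simp
  | cons i ω ih =>
    rw [List.cons_append, leftInvSeq, leftInvSeq, ih, List.map_append, List.map_map,
      List.cons_append, wordProd_cons, map_mul, MulAut.coe_mul]

theorem wordProd_complementWord_eq_iff {c Q : List B} (F : Finset (Fin (c ++ Q).length)) :
    cs.wordProd (complementWord (c ++ Q) F) = cs.wordProd Q ↔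
      (F.sort.map fun i : Fin (c ++ Q).length =>
        MulAut.conj (cs.wordProd c)⁻¹ ((cs.leftInvSeq (c ++ Q)).getD i 1)).prod =
          (cs.wordProd c)⁻¹ := by
  rw [wordProd_complementWord, wordProd_append, ← mul_assoc, mul_eq_right, ← eq_inv_iff_mul_eq_one,
    ← Function.comp_def (MulAut.conj (cs.wordProd c)⁻¹), ← List.map_map, ← map_list_prod]
  rw [MulAut.conj_apply, inv_inv, mul_assoc, mul_eq_left, eq_inv_iff_mul_eq_one]

end ComplementWord

/-! ### The powers of the longest element -/

section LongestPowWord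

variable {B W : Type*} [Group W] {M : CoxeterMatrix B} {cs : CoxeterSystem M W} {c : List B}

theorem isReduced_sortingWord (hc : IsCoxeterWord c) (w : W) :
    cs.IsReduced (cs.sortingWord hc w) := by
  obtain ⟨f, hf, -⟩ := (cs.exists_isSortingWord hc w).choose_spec
  exact hf.2.2.1

theorem wordProd_sortingWord (hc : IsCoxeterWord c) (w : W) :
    cs.wordProd (cs.sortingWord hc w) = w := by
  obtain ⟨f, hf, -⟩ := (cs.exists_isSortingWord hc w).choose_spec
  exact hf.2.2.2

theorem length_sortingWord (hc : IsCoxeterWord c) (w : W) :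
    (cs.sortingWord hc w).length = cs.length w := by
  rw [← isReduced_sortingWord hc, wordProd_sortingWord]

variable [Finite W]

theorem longestPowWord_succ (hc : IsCoxeterWord c) (m : ℕ) :
    cs.longestPowWord hc (m + 1) = cs.longestPowWord hc m ++
      if Even m then cs.sortingWord hc cs.longest
      else (cs.sortingWord hc cs.longest).map cs.conjLongest := by
  rw [longestPowWord, List.range_succ, List.flatMap_append, List.flatMap_singleton, longestPowWord]

theorem length_longestPowWord (hc : IsCoxeterWord c) (m : ℕ) :
    (cs.longestPowWord hc m).length = m * cs.length cs.longest := by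
  induction m with
  | zero => simp [longestPowWord]
  | succ m ih =>
    rw [longestPowWord_succ, List.length_append, ih, add_mul, one_mul,
      apply_ite List.length, List.length_map, ite_self, length_sortingWord]

theorem finite_of_isCoxeterWord (hc : IsCoxeterWord c) : Finite B :=
  Finite.of_surjective c.get fun i => List.mem_iff_get.1 (hc.2 i)

variable (cs) in
theorem wordProd_map_conjLongest [Finite B] (ω : List B) :
    cs.wordProd (ω.map cs.conjLongest) = cs.longest * cs.wordProd ω * cs.longest⁻¹ := by
  induction ω with
  | nil => simp
  | cons i ω ih =>
    rw [List.map_cons, wordProd_cons, ih, simple_conjLongest, wordProd_cons]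
    group

variable (cs) in
theorem leftInvSeq_map_conjLongest [Finite B] (ω : List B) :
    cs.leftInvSeq (ω.map cs.conjLongest) = (cs.leftInvSeq ω).map (MulAut.conj cs.longest) := by
  induction ω with
  | nil => simp
  | cons i ω ih =>
    rw [List.map_cons, leftInvSeq, ih, simple_conjLongest, leftInvSeq, List.map_cons, List.map_map,
      List.map_map, MulAut.conj_apply, ← MulAut.coe_mul, ← MulAut.coe_mul, ← map_mul, ← map_mul,
      inv_mul_cancel_right]

theorem wordProd_longestPowWord (hc : IsCoxeterWord c) (m : ℕ) :
    cs.wordProd (cs.longestPowWord hc m) = cs.longest ^ m := by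
  have := finite_of_isCoxeterWord hc
  induction m with
  | zero => simp [longestPowWord]
  | succ m ih =>
    rw [longestPowWord_succ, wordProd_append, ih, pow_succ]
    split_ifs
    · rw [wordProd_sortingWord]
    · rw [wordProd_map_conjLongest, wordProd_sortingWord, mul_inv_cancel_right]

variable (cs) in
theorem longest_pow [Finite B] (m : ℕ) : cs.longest ^ m = if Even m then 1 else cs.longest := by
  split_ifs with h
  · obtain ⟨r, rfl⟩ := h
    rw [← two_mul, pow_mul, pow_two, longest_mul_longest, one_pow]
  · obtain ⟨r, rfl⟩ := Nat.not_even_iff_odd.1 h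
    rw [pow_succ, pow_mul, pow_two, longest_mul_longest, one_pow, one_mul]

/-- Conjugating every second factor makes the inversion sequence periodic. -/
theorem leftInvSeq_longestPowWord_succ (hc : IsCoxeterWord c) (m : ℕ) :
    cs.leftInvSeq (cs.longestPowWord hc (m + 1)) = cs.leftInvSeq (cs.longestPowWord hc m) ++
      cs.leftInvSeq (cs.sortingWord hc cs.longest) := by
  have := finite_of_isCoxeterWord hc
  rw [longestPowWord_succ, leftInvSeq_append, wordProd_longestPowWord, longest_pow]
  congr 1
  split_ifs
  · simp
  · rw [leftInvSeq_map_conjLongest, List.map_map, ← MulAut.coe_mul, ← map_mul, longest_mul_longest,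
      map_one, MulAut.coe_one, List.map_id]

theorem leftInvSeq_longestPowWord [Fintype B] [DecidableEq B] (hc : IsCoxeterWord c)
    (hn : 0 < c.length) (m : ℕ) :
    cs.leftInvSeq (cs.longestPowWord hc m) = (List.range (m * cs.length cs.longest)).map fun i =>
      cyclicReflection cs hn (sortingPosition cs hn (i % cs.length cs.longest)) := by
  induction m with
  | zero => simp [longestPowWord]
  | succ m ih =>
    rw [leftInvSeq_longestPowWord_succ, ih, leftInvSeq_sortingWord_longest hc hn, add_mul, one_mul,
      List.range_add, List.map_append, List.map_map]
    congr 1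
    refine List.map_congr_left fun i hi => ?_
    rw [Function.comp_apply, Nat.mul_add_mod', Nat.mod_eq_of_lt (List.mem_range.1 hi)]

end LongestPowWord

/-! ### Facets as exceptional sets -/

section ExceptionalSets

variable {B W : Type*} [Group W] {M : CoxeterMatrix B} {cs : CoxeterSystem M W} {c : List B}

theorem finrank_eq_length (hc : IsCoxeterWord c) : Module.finrank ℝ (B → ℝ) = c.length := by
  classical
  have : Fintype B := ⟨c.toFinset, fun i => List.mem_toFinset.2 (hc.2 i)⟩
  rw [Module.finrank_fintype_fun_eq_card, ← List.toFinset_card_of_nodup hc.1, ← Finset.card_univ]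
  congr 1
  ext i
  simp [hc.2 i]

variable [Fintype B] [DecidableEq B] [Finite W]
  {ι : Type*} [LinearOrder ι] {t : ι → W} {β : ι → B → ℝ} {F : Finset ι}

theorem isExceptional_of_prod_eq (hc : IsCoxeterWord c)
    (h : ∀ i, IsReflectionAlong cs (t i) (β i)) (hF : F.card = c.length)
    (hprod : (F.sort.map t).prod = (cs.wordProd c)⁻¹) :
    IsExceptional (eulerForm M c) β ⊤ F := by
  have hfold (x : B → ℝ) : (F.sort.map β).foldl (reflectAlong (eulerForm M c)) x =
      (geomRep cs (cs.wordProd c)).toLinearMap x :=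
    (foldl_reflectAlong hc F.sort (fun i _ => h i) x).trans (by rw [hprod, inv_inv])
  have hpairwise := pairwise_of_foldl_reflectAlong (eulerForm M c)
    (fun x hx => (eulerForm_pos cs hc hx).ne')
    (by rw [List.length_map, Finset.length_sort, hF, finrank_eq_length hc])
    (List.forall_mem_map.2 fun i _ => (h i).ne_zero) hfold
    fun x y => (eulerForm_sub_wordProd cs hc x y).trans (eulerForm_add_flip hc x y).symm
  rw [List.pairwise_map] at hpairwise
  refine ⟨fun _ _ => Submodule.mem_top, fun i hi j hj hij => ?_,
    by rw [finrank_top, hF, finrank_eq_length hc]⟩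
  obtain ⟨a, ha, rfl⟩ := List.mem_iff_getElem.1 ((Finset.mem_sort (· ≤ ·)).2 hi)
  obtain ⟨b, hb, rfl⟩ := List.mem_iff_getElem.1 ((Finset.mem_sort (· ≤ ·)).2 hj)
  exact List.pairwise_iff_getElem.1 hpairwise a b ha hb
    (F.sortedLT_sort.getElem_lt_getElem_iff.1 hij)

theorem IsExceptional.prod_eq (hF : IsExceptional (eulerForm M c) β ⊤ F) (hc : IsCoxeterWord c)
    (h : ∀ i, IsReflectionAlong cs (t i) (β i)) : (F.sort.map t).prod = (cs.wordProd c)⁻¹ := by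
  have hself (i : ι) : eulerForm M c (β i) (β i) ≠ 0 := (eulerForm_pos cs hc (h i).ne_zero).ne'
  have hpairwise : (F.sort.map β).Pairwise fun g g' => eulerForm M c g' g = 0 := by
    rw [List.pairwise_map]
    exact F.sortedLT_sort.pairwise.imp_of_mem fun hi hj hij =>
      hF.triangular _ ((Finset.mem_sort _).1 hi) _ ((Finset.mem_sort _).1 hj) hij
  rw [← inv_eq_iff_eq_inv]
  refine geomRep_injective cs (LinearEquiv.ext fun x => ?_)
  have hfold := foldl_reflectAlong hc F.sort (fun i _ => h i) x
  rw [← hfold, ← sub_eq_zero]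
  by_contra hne
  refine (eulerForm_pos cs hc hne).ne'
    (hF.eq_zero_of_forall_mem hself (fun i hi => ?_) Submodule.mem_top)
  have hdiff := apply_sub_foldl_reflectAlong (eulerForm M c) hpairwise
    (List.forall_mem_map.2 fun i _ => hself i) x
    (List.mem_map_of_mem ((Finset.mem_sort _).2 hi))
  have hcox := eulerForm_sub_wordProd cs hc x (β i)
  rw [← eulerForm_add_flip hc] at hcox
  rw [map_sub, LinearMap.sub_apply] at hdiff hcox ⊢
  linarith

end ExceptionalSets

section SubwordComplex

variable {B W : Type*} [Group W] [Finite W] {M : CoxeterMatrix B} {cs : CoxeterSystem M W}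
  {c Q : List B} {m : ℕ}

section

variable [Fintype B] [DecidableEq B] {hn : 0 < c.length}

theorem isReflectionAlong_getElem_leftInvSeq (hc : IsCoxeterWord c)
    (hQ : Q <+: cs.longestPowWord hc m) {i : ℕ} (hi : i < (cs.leftInvSeq Q).length) :
    IsReflectionAlong cs (getElem (cs.leftInvSeq Q) i hi) (signedRoot cs hn i) := by
  obtain ⟨R, hR⟩ := hQ
  have hprefix : cs.leftInvSeq Q <+: cs.leftInvSeq (cs.longestPowWord hc m) := by
    rw [← hR, leftInvSeq_append]
    exact List.prefix_append _ _
  rw [leftInvSeq_longestPowWord hc hn] at hprefix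
  rw [hprefix.getElem hi, List.getElem_map, List.getElem_range, signedRoot]
  have hrefl := isReflectionAlong_cyclicReflection cs hn
    (sortingPosition cs hn (i % cs.length cs.longest))
  rcases neg_one_pow_eq_or ℝ (i / cs.length cs.longest) with h | h
  · rwa [h, one_smul]
  · rw [h, neg_one_smul]
    exact hrefl.neg

theorem isReflectionAlong_positionVector (hc : IsCoxeterWord c)
    (hQ : Q <+: cs.longestPowWord hc m) {i : ℕ} (hi : i < (c ++ Q).length) :
    IsReflectionAlong cs (MulAut.conj (cs.wordProd c)⁻¹ ((cs.leftInvSeq (c ++ Q)).getD i 1))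
      (positionVector c.length (initialRoot cs hn) (signedRoot cs hn) i) := by
  rw [leftInvSeq_append]
  rcases lt_or_ge i c.length with h | h
  · rw [positionVector_of_lt h, List.getD_append _ _ _ _ (by simpa using h),
      List.getD_eq_getElem _ _ (by simpa using h), getElem_leftInvSeq _ _ _ h, initialRoot,
      MulAut.conj_apply]
    have hrefl := isReflectionAlong_cyclicReflection cs hn i
    rw [cyclicReflection, prefixElement_of_lt cs h, cyclicLetter_of_lt hn h] at hrefl
    exact (hrefl.conj _).neg
  · obtain ⟨j, rfl⟩ := Nat.exists_eq_add_of_le h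
    have hj : j < (cs.leftInvSeq Q).length := by
      rw [List.length_append] at hi
      simpa using hi
    rw [positionVector_add, List.getD_append_right _ _ _ _ (by simp), length_leftInvSeq,
      Nat.add_sub_cancel_left, List.getD_eq_getElem _ _ (by simpa using hj), List.getElem_map,
      ← MulAut.mul_apply, ← map_mul, inv_mul_cancel, map_one, MulAut.one_apply]
    exact isReflectionAlong_getElem_leftInvSeq hc hQ hj

variable (hn) in
theorem setOf_complementWord_eq_setOf_isExceptional (hc : IsCoxeterWord c)
    (hQ : Q <+: cs.longestPowWord hc m) :
    {F | (complementWord (c ++ Q) F).length = Q.length ∧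
        cs.wordProd (complementWord (c ++ Q) F) = cs.wordProd Q} =
      {F | IsExceptional (eulerForm M c) (fun i : Fin (c ++ Q).length =>
        positionVector c.length (initialRoot cs hn) (signedRoot cs hn) i) ⊤ F} := by
  ext F
  have hrefl (i : Fin (c ++ Q).length) :=
    isReflectionAlong_positionVector (hn := hn) hc hQ i.isLt
  rw [Set.mem_ofPred_eq, Set.mem_ofPred_eq, length_complementWord_eq_iff,
    wordProd_complementWord_eq_iff]
  refine ⟨fun ⟨hcard, hprod⟩ => isExceptional_of_prod_eq hc hrefl hcard hprod,
    fun hF => ⟨?_, hF.prod_eq hc hrefl⟩⟩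
  rw [hF.card_eq, finrank_top, finrank_eq_length hc]

end

theorem lexExchange_setOf_complementWord (hc : IsCoxeterWord c)
    (hQ : Q <+: cs.longestPowWord hc m) :
    LexExchange {F | (complementWord (c ++ Q) F).length = Q.length ∧
      cs.wordProd (complementWord (c ++ Q) F) = cs.wordProd Q} := by
  classical
  have := finite_of_isCoxeterWord hc
  have := Fintype.ofFinite B
  intro F hF G hG v
  have hn : 0 < c.length := List.length_pos_of_mem (hc.2 ((c ++ Q).get v))
  have hseq := isSortedRootSequence (cs := cs) hc hn
  rw [setOf_complementWord_eq_setOf_isExceptional hn hc hQ] at hF hG ⊢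
  exact IsExceptional.lexExchange
    (η := fun i : Fin _ => positionVector c.length (initialRoot cs hn) (signedRoot cs hn) i)
    (fun i => (hseq.positionVector_pos i).ne')
    (hseq.exchangeProperty.comp_finVal _) F hF G hG v

theorem vertexDecomposable_subwordComplex (hc : IsCoxeterWord c)
    (hQ : Q <+: cs.longestPowWord hc m) :
    (cs.subwordComplex (c ++ Q) (cs.wordProd Q) Q.length).VertexDecomposable :=
  (lexExchange_setOf_complementWord hc hQ).vertexDecomposable_lowerClosure
    (fun F _ => F.subset_univ) (fun _ hF => (length_complementWord_eq_iff _).1 hF.1)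
    ⟨_, congrArg List.length (complementWord_append c Q),
      congrArg cs.wordProd (complementWord_append c Q)⟩

theorem isShellingOrder_subwordComplex (hc : IsCoxeterWord c)
    (hQ : Q <+: cs.longestPowWord hc m) :
    (cs.subwordComplex (c ++ Q) (cs.wordProd Q) Q.length).IsShellingOrder lexLT := by
  refine LexExchange.isShellingOrder_lexLT ?_
  rw [subwordComplex,
    facets_lowerClosure_of_card fun _ hF => (length_complementWord_eq_iff _).1 hF.1]
  exact lexExchange_setOf_complementWord hc hQ

end SubwordComplex

end ClusterComplex

theorem mainTheorem8 {B W : Type*} [Group W] [Finite W] {M : CoxeterMatrix B}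
    (cs : CoxeterSystem M W) (c : List B) (hc : CoxeterSystem.IsCoxeterWord c) (m : ℕ) :
    (∀ Q : List B, Q <+: cs.longestPowWord hc m →
      (cs.subwordComplex (c ++ Q) (cs.wordProd Q) Q.length).VertexDecomposable) ∧
    (cs.clusterComplex hc m).VertexDecomposable ∧
    (cs.clusterComplex hc m).IsShellingOrder FaceComplex.lexLT := by
  rw [CoxeterSystem.clusterComplex, ← ClusterComplex.wordProd_longestPowWord hc,
    ← ClusterComplex.length_longestPowWord hc]
  exact ⟨fun Q hQ => ClusterComplex.vertexDecomposable_subwordComplex hc hQ,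
    ClusterComplex.vertexDecomposable_subwordComplex hc (List.prefix_refl _),
    ClusterComplex.isShellingOrder_subwordComplex hc (List.prefix_refl _)⟩
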